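/- A size pair $(\mathcal M,\varphi)$ consists of a non-empty compact, connected and locally connected Hausdorff space $\mathcal M$ and a continuous function $\varphi:\mathcal M\to\mathbb R$. Write $\Delta^+=\{(x,y)\in\mathbb R^2:x<y\}$, $\Delta=\{(x,x):x\in\mathbb R\}$ and $\bar\Delta^*=\Delta^+\cup\Delta\cup\{(k,\infty):k\in\mathbb R\}$. Reduced size function. For $(x,y)\in\Delta^+$ let $\ell^*_{(\mathcal M,\varphi)}(x,y)\in\mathbb N$ be the number of equivalence classes of $\{P\in\mathcal M:\varphi(P)\le x\}$ under the relation: $P\sim Q$ if some connected subset of $\{\varphi\le y\}$ contains both $P$ and $Q$. Cornerpoints. Let $\ell^*$ be a reduced size function. The multiplicity $\mu(p)$ of $p=(x,y)\in\Delta^+$ is the minimum, over all $\epsilon>0$ with $x+\epsilon<y-\epsilon$, of $$\ell^*(x+\epsilon,y-\epsilon)-\ell^*(x-\epsilon,y-\epsilon)-\ell^*(x+\epsilon,y+\epsilon)+\ell^*(x-\epsilon,y+\epsilon),$$ and $p$ is a proper cornerpoint if $\mu(p)>0$. The multiplicity of $(k,\infty)$ is the minimum, over all $\epsilon>0$ with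 $k+\epsilon<1/\epsilon$, of $\ell^*(k+\epsilon,1/\epsilon)-\ell^*(k-\epsilon,1/\epsilon)$, and $(k,\infty)$ is a cornerpoint at infinity if this is positive. Matching distance. On $\bar\Delta^*$ put $$d((x,y),(x',y'))=\min\Big\{\max\{|x-x'|,|y-y'|\},\max\Big\{\frac{y-x}2,\frac{y'-x'}2\Big\}\Big\}$$ for $y,y'<\infty$, $d((k,\infty),(k',\infty))=|k-k'|$, and $d=\infty$ between a point at infinity and a finite point. A representative sequence of $\ell^*$ is a sequence $(a_i)_{i\in\mathbb N}$ (indexed from $0$) in $\bar\Delta^*$ such that $a_0$ is a cornerpoint at infinity of $\ell^*$; for every $i>0$, $a_i$ is a proper cornerpoint of $\ell^*$ or lies on $\Delta$; every proper cornerpoint $p$ equals $a_i$ for exactly $\mu(p)$ indices $i$; and $a_i\in\Delta$ for infinitely many $i$. For representative sequences $(a_i)$ of $\ell_1^*$ and $(b_i)$ of $\ell_2^*$ set $$d_{match}(\ell_1^*,\ell_2^*)=\inf_\sigma\sup_{i\in\mathbb N}d(a_i,b_{\sigma(i)}),$$ where $\sigma$ ranges over all bijections $\mathbb N\to\mathbb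 N$. Theorem. Let $(\mathcal M,\varphi)$ and $(\mathcal N,\psi)$ be size pairs with $\mathcal M$ and $\mathcal N$ homeomorphic. Then $\ell^*_{(\mathcal M,\varphi)}$ and $\ell^*_{(\mathcal N,\psi)}$ have representative sequences, the value $d_{match}(\ell^*_{(\mathcal M,\varphi)},\ell^*_{(\mathcal N,\psi)})$ does not depend on the choice of these sequences, and $$d_{match}\big(\ell^*_{(\mathcal M,\varphi)},\ell^*_{(\mathcal N,\psi)}\big)\le\inf_h\max_{P\in\mathcal M}|\varphi(P)-\psi(h(P))|,$$ where $h$ ranges over all homeomorphisms from $\mathcal M$ to $\mathcal N$. -/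

import Mathlib

open scoped ENNReal

namespace SizeTheory

/-- The open half-plane `x < y` above the diagonal. -/
abbrev DeltaPlus : Type := {p : ℝ × ℝ // p.1 < p.2}

section ReducedSizeFunction

/-- The lower level set of `φ` at level `x`. -/
def lowerLevel {M : Type*} (φ : M → ℝ) (x : ℝ) : Set M := {P | φ P ≤ x}

/-- Two points are `⟨φ ≤ y⟩`-connected if some connected subset of the lower level set of `φ`
at level `y` contains both of them. -/
def LevelConnected {M : Type*} [TopologicalSpace M] (φ : M → ℝ) (y : ℝ) (P Q : M) : Prop :=
  ∃ C : Set M, C ⊆ lowerLevel φ y ∧ IsConnected C ∧ P ∈ C ∧ Q ∈ C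

/-- For `x ≤ y`, the relation of `⟨φ ≤ y⟩`-connectedness on the lower level set at level `x`. -/
def levelSetoid {M : Type*} [TopologicalSpace M] (φ : M → ℝ) (x y : ℝ) (hxy : x ≤ y) :
    Setoid (lowerLevel φ x) where
  r P Q := LevelConnected φ y P Q
  iseqv :=
    { refl := fun P => ⟨{(P : M)}, by
        rintro Q rfl
        exact le_trans P.2 hxy, isConnected_singleton, rfl, rfl⟩
      symm := fun ⟨C, hC, hc, hP, hQ⟩ => ⟨C, hC, hc, hQ, hP⟩
      trans := fun ⟨C, hC, hc, hP, hQ⟩ ⟨D, hD, hd, hQ', hR⟩ =>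
        ⟨C ∪ D, Set.union_subset hC hD, hc.union ⟨_, hQ, hQ'⟩ hd, Or.inl hP, Or.inr hR⟩ }

/-- The reduced size function of `(M, φ)`: at `(x, y)`, the number of equivalence classes of the
lower level set at level `x` under `⟨φ ≤ y⟩`-connectedness.  For continuous `φ` on a compact
locally connected space this number is finite. -/
noncomputable def reducedSizeFunction {M : Type*} [TopologicalSpace M] (φ : M → ℝ) :
    DeltaPlus → ℕ :=
  fun p => Nat.card (Quotient (levelSetoid φ p.1.1 p.1.2 p.2.le))

end ReducedSizeFunction

section Cornerpoints

/-- The multiplicity of a point `p = (x, y)` with `x < y`: the minimum, over all `ε > 0` with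
`x + ε < y - ε`, of the alternating sum below.  The subtractions are those of the integers. -/
noncomputable def multiplicity (l : DeltaPlus → ℕ) (p : DeltaPlus) : ℤ :=
  sInf {n : ℤ | ∃ (ε : ℝ) (h0 : 0 < ε) (h : p.1.1 + ε < p.1.2 - ε),
    n = (l ⟨(p.1.1 + ε, p.1.2 - ε), h⟩ : ℤ)
      - (l ⟨(p.1.1 - ε, p.1.2 - ε), by dsimp only; linarith⟩ : ℤ)
      - (l ⟨(p.1.1 + ε, p.1.2 + ε), by dsimp only; linarith⟩ : ℤ)
      + (l ⟨(p.1.1 - ε, p.1.2 + ε), by dsimp only; linarith⟩ : ℤ)}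

/-- Proper cornerpoints are the points of the open half-plane with positive multiplicity. -/
def IsProperCornerpoint (l : DeltaPlus → ℕ) (p : DeltaPlus) : Prop :=
  0 < multiplicity l p

/-- The multiplicity of the vertical line of abscissa `k`, identified with `(k, ∞)`. -/
noncomputable def multiplicityAtInfinity (l : DeltaPlus → ℕ) (k : ℝ) : ℤ :=
  sInf {n : ℤ | ∃ (ε : ℝ) (h0 : 0 < ε) (h : k + ε < 1 / ε),
    n = (l ⟨(k + ε, 1 / ε), h⟩ : ℤ)
      - (l ⟨(k - ε, 1 / ε), by dsimp only; linarith⟩ : ℤ)}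

/-- Cornerpoints at infinity are the vertical lines with positive multiplicity. -/
def IsCornerpointAtInfinity (l : DeltaPlus → ℕ) (k : ℝ) : Prop :=
  0 < multiplicityAtInfinity l k

/-- The closed half-plane `x ≤ y`, extended by the points at infinity `(k, ∞)`. -/
inductive ExtPoint : Type
  | finite (x y : ℝ) (h : x ≤ y) : ExtPoint
  | infinite (k : ℝ) : ExtPoint

/-- A point of the open half-plane as a point of the extended closed half-plane. -/
def DeltaPlus.toExt (p : DeltaPlus) : ExtPoint := ExtPoint.finite p.1.1 p.1.2 p.2.le

/-- Membership in the diagonal. -/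
def ExtPoint.OnDiagonal (q : ExtPoint) : Prop :=
  ∃ x : ℝ, q = ExtPoint.finite x x le_rfl

/-- The pseudo-distance `d` on the extended closed half-plane: the smaller of the cost of moving
one point to the other and the cost of moving both onto the diagonal, in the max-norm, with
`∞ - y = y - ∞ = ∞` for finite `y`, `∞ - ∞ = 0` and `∞ / 2 = ∞`. -/
noncomputable def ExtPoint.d : ExtPoint → ExtPoint → ℝ≥0∞
  | .finite x y _, .finite x' y' _ =>
      ENNReal.ofReal (min (max |x - x'| |y - y'|) (max ((y - x) / 2) ((y' - x') / 2)))
  | .infinite k, .infinite k' => ENNReal.ofReal |k - k'|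
  | .finite _ _ _, .infinite _ => ⊤
  | .infinite _, .finite _ _ _ => ⊤

end Cornerpoints

section MatchingDistance

/-- Representative sequences of `l`: the term of index `0` is the cornerpoint at infinity, every
other term is a proper cornerpoint or a point of the diagonal, every proper cornerpoint occurs as
often as its multiplicity says, and the diagonal is visited infinitely often. -/
structure IsRepresentativeSequence (l : DeltaPlus → ℕ) (a : ℕ → ExtPoint) : Prop where
  zero : ∃ k : ℝ, IsCornerpointAtInfinity l k ∧ a 0 = ExtPoint.infinite k
  pos : ∀ i : ℕ, 0 < i →
    (∃ p : DeltaPlus, IsProperCornerpoint l p ∧ a i = p.toExt) ∨ (a i).OnDiagonal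
  card : ∀ p : DeltaPlus, IsProperCornerpoint l p →
    (({i : ℕ | a i = p.toExt}.ncard : ℕ) : ℤ) = multiplicity l p
  diagonal : {i : ℕ | (a i).OnDiagonal}.Infinite

/-- The infimum over the bijections `σ` of `ℕ` of the supremum over `i` of `d (a i) (b (σ i))`. -/
noncomputable def matchingCost (a b : ℕ → ExtPoint) : ℝ≥0∞ :=
  ⨅ σ : Equiv.Perm ℕ, ⨆ i : ℕ, (a i).d (b (σ i))

/-- The matching distance: the matching cost of representative sequences of `l₁` and `l₂`.  The
cost does not depend on the choice of the sequences when `l₁` and `l₂` are reduced size functions;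
the infimum over all choices is the common value (and `⊤` if there is no choice). -/
noncomputable def matchingDist (l₁ l₂ : DeltaPlus → ℕ) : ℝ≥0∞ :=
  ⨅ (a : ℕ → ExtPoint) (b : ℕ → ExtPoint) (_ : IsRepresentativeSequence l₁ a)
    (_ : IsRepresentativeSequence l₂ b), matchingCost a b

end MatchingDistance

/-- The natural pseudo-distance: the infimum over the homeomorphisms `h` from `M` to `N` of the
largest value of `|φ P - ψ (h P)|` (a maximum, since `M` is compact and non-empty and `φ`, `ψ` are
continuous in the situations considered). -/
noncomputable def naturalPseudoDist {M N : Type*} [TopologicalSpace M] [TopologicalSpace N]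
    (φ : M → ℝ) (ψ : N → ℝ) : ℝ :=
  ⨅ h : M ≃ₜ N, ⨆ P : M, |φ P - ψ (h P)|

end SizeTheory

/-! Transport `ψ` along a homeomorphism, so that both functions live on one space, and let `h` bound
`|φ - ψ|`. Besides the size functions V of `φ` and W of `ψ`, consider R(x, y), the number of
components of {ψ ≤ y + h} that meet {φ ≤ x}. When the lower level set grows, coarsening the
components of the upper one can only reduce the number of newly met components
(`ncard_image_add_le`, `pairRank_add_le`). Hence V, R and W all have nonnegative alternating sums,
and their cornerpoints can be read as bars (birth, death).

The same inequality compares bars line by line. On a vertical line, R has at most as many bars of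
length at least t as V, and at least as many as V has of length at least t + 2h. Listing the bars of
a line by decreasing length and pairing equal ranks sends each bar of R to a bar of V with the same
birth and a death later by at most 2h. On horizontal lines each bar of R goes to a bar of W whose
death is raised by h and whose length grows by at most 2h. Through R, bars of V and W are matched
with both coordinates moved by at most h, and unmatched bars have length at most 2h
(`exists_barcode_matching`), so the diagonal absorbs them at cost at most h. The points at infinity
sit at the two minima, which differ by at most h.

Representative sequences exist because there are countably many cornerpoints. Two of them differ by
a permutation and by the choice of diagonal points, which `d` does not see (`exists_perm`). -/

namespace SizeTheory

/-! ### Counting bars near a line -/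

/-- A two-parameter family `G ε s`, for `0 < ε < s`, that counts the bars whose length is more than
`s` and whose fixed endpoint lies within `ε` of a given line; `c` counts those of infinite length
on the line itself. -/
structure IsLineFamily (G : ℝ → ℝ → ℕ) (c : ℕ) : Prop where
  mono : ∀ ⦃ε ε' s : ℝ⦄, 0 < ε → ε ≤ ε' → ε' < s → G ε s ≤ G ε' s
  anti : ∀ ⦃ε s s' : ℝ⦄, 0 < ε → ε < s → s ≤ s' → G ε s' ≤ G ε s
  super : ∀ ⦃ε ε' s s' : ℝ⦄, 0 < ε → ε ≤ ε' → ε' < s → s ≤ s' →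
    G ε s + G ε' s' ≤ G ε' s + G ε s'
  eventually_eq : ∃ ε₀ S : ℝ, 0 < ε₀ ∧ ∀ ε s : ℝ, 0 < ε → ε < ε₀ → ε < s → S < s → G ε s = c

/-- The number of bars on the line of length at least `t`. -/
noncomputable def lineCount (G : ℝ → ℝ → ℕ) (t : ℝ) : ℕ :=
  sInf {n : ℕ | ∃ ε s : ℝ, 0 < ε ∧ ε < s ∧ s < t ∧ n = G ε s}

lemma lineCount_le (G : ℝ → ℝ → ℕ) {ε s t : ℝ} (h0 : 0 < ε) (h1 : ε < s) (h2 : s < t) :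
    lineCount G t ≤ G ε s :=
  Nat.sInf_le ⟨ε, s, h0, h1, h2, rfl⟩

lemma exists_lineCount_eq (G : ℝ → ℝ → ℕ) {t : ℝ} (ht : 0 < t) :
    ∃ ε s : ℝ, 0 < ε ∧ ε < s ∧ s < t ∧ lineCount G t = G ε s :=
  Nat.sInf_mem (s := {n : ℕ | ∃ ε s : ℝ, 0 < ε ∧ ε < s ∧ s < t ∧ n = G ε s})
    ⟨_, t / 3, t / 2, by linarith, by linarith, by linarith, rfl⟩

lemma lineCount_anti (G : ℝ → ℝ → ℕ) {t t' : ℝ} (ht : 0 < t) (h : t ≤ t') :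
    lineCount G t' ≤ lineCount G t := by
  obtain ⟨ε, s, h0, h1, h2, e⟩ := exists_lineCount_eq G ht
  rw [e]
  exact lineCount_le G h0 h1 (h2.trans_le h)

/-- Left-continuity: the minimum at `t` is attained at some `s < t`, so it stays available for all
lengths in `(s, t)`. -/
lemma lineCount_left (G : ℝ → ℝ → ℕ) {t : ℝ} (ht : 0 < t) :
    ∃ s : ℝ, 0 < s ∧ s < t ∧ lineCount G s = lineCount G t := by
  obtain ⟨ε, s, h0, h1, h2, e⟩ := exists_lineCount_eq G ht
  refine ⟨(s + t) / 2, by linarith, by linarith, le_antisymm ?_ ?_⟩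
  · rw [e]
    exact lineCount_le G h0 h1 (by linarith)
  · exact lineCount_anti G (by linarith) (by linarith)

namespace IsLineFamily

variable {G : ℝ → ℝ → ℕ} {c : ℕ}

/-- A minimizing pair `(ε₁, s₁)` remains minimizing when `ε` shrinks and `s` grows towards `t`. By
`super`, the bars off the line that are seen within `ε₁` do not increase in number with `s`; none
are left at `s₁`, so `G` does not depend on `ε ≤ ε₁` even for `s ≥ t`. -/
lemma stable (hG : IsLineFamily G c) {t : ℝ} (ht : 0 < t) :
    ∃ ε₁ s₁ : ℝ, 0 < ε₁ ∧ ε₁ < s₁ ∧ s₁ < t ∧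
      (∀ ε s : ℝ, 0 < ε → ε ≤ ε₁ → s₁ ≤ s → s < t → G ε s = lineCount G t) ∧
      ∀ ε s : ℝ, 0 < ε → ε ≤ ε₁ → s₁ ≤ s → G ε s = G ε₁ s := by
  obtain ⟨ε₁, s₁, h0, h1, h2, e⟩ := exists_lineCount_eq G ht
  have key : ∀ ε s : ℝ, 0 < ε → ε ≤ ε₁ → s₁ ≤ s → s < t → G ε s = lineCount G t := by
    intro ε s hε hε' hs hst
    refine le_antisymm ?_ (lineCount_le G hε (by linarith) hst)
    rw [e]
    exact (hG.mono hε hε' (by linarith)).trans (hG.anti h0 h1 hs)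
  refine ⟨ε₁, s₁, h0, h1, h2, key, fun ε s hε hε' hs => ?_⟩
  have a := hG.super hε hε' h1 hs
  have b := hG.mono hε hε' (h1.trans_le hs)
  have d := key ε s₁ hε hε' le_rfl h2
  omega

lemma exists_lineCount_eq_of_lt (hG : IsLineFamily G c) :
    ∃ S : ℝ, ∀ t : ℝ, S < t → lineCount G t = c := by
  obtain ⟨ε₀, S, h0, h⟩ := hG.eventually_eq
  refine ⟨max S 0, fun t ht => ?_⟩
  have h1 : S < t := (le_max_left _ _).trans_lt ht
  have h2 : 0 < t := (le_max_right _ _).trans_lt ht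
  obtain ⟨ε₁, s₁, a0, a1, a2, a3, -⟩ := hG.stable h2
  have b1 : max S s₁ < t := max_lt h1 a2
  have b2 := le_max_left S s₁
  have b3 := le_max_right S s₁
  have b4 := min_le_left ε₁ (ε₀ / 2)
  have b5 := min_le_right ε₁ (ε₀ / 2)
  have b6 : 0 < min ε₁ (ε₀ / 2) := lt_min a0 (by linarith)
  rw [← a3 (min ε₁ (ε₀ / 2)) ((max S s₁ + t) / 2) b6 b4 (by linarith) (by linarith)]
  exact h _ _ b6 (by linarith) (by linarith) (by linarith)

lemma le_lineCount (hG : IsLineFamily G c) {t : ℝ} (ht : 0 < t) : c ≤ lineCount G t := by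
  obtain ⟨S, hS⟩ := hG.exists_lineCount_eq_of_lt
  rw [← hS (max S t + 1) (by have := le_max_left S t; linarith)]
  exact lineCount_anti G ht (by have := le_max_right S t; linarith)

/-- The jump of the count at `t`, as the smallest difference across `t`. -/
lemma exists_jump (hG : IsLineFamily G c) {t : ℝ} (ht : 0 < t) :
    ∃ f : ℕ, c ≤ f ∧ f ≤ lineCount G t ∧
      (∃ δ : ℝ, 0 < δ ∧ ∀ t', t < t' → t' < t + δ → lineCount G t' = f) ∧
      IsLeast {n : ℤ | ∃ ε : ℝ, 0 < ε ∧ ε < t - ε ∧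
        n = (G ε (t - ε) : ℤ) - (G ε (t + ε) : ℤ)} ((lineCount G t : ℤ) - (f : ℤ)) := by
  obtain ⟨ε₁, s₁, a0, a1, a2, a3, a4⟩ := hG.stable ht
  -- the right limit of `G ε₁` at `t`
  have hbdd : BddAbove {n : ℕ | ∃ s, t < s ∧ n = G ε₁ s} :=
    ⟨G ε₁ s₁, by
      rintro n ⟨s, hs, rfl⟩
      exact hG.anti a0 a1 (by linarith)⟩
  obtain ⟨s₂, hs₂, e₂⟩ := Nat.sSup_mem (s := {n : ℕ | ∃ s, t < s ∧ n = G ε₁ s})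
    ⟨_, t + 1, by linarith, rfl⟩ hbdd
  set f := sSup {n : ℕ | ∃ s, t < s ∧ n = G ε₁ s}
  have hconst : ∀ s, t < s → s ≤ s₂ → G ε₁ s = f := by
    intro s h1 h2
    refine le_antisymm (le_csSup hbdd ⟨s, h1, rfl⟩) ?_
    rw [e₂]
    exact hG.anti a0 (by linarith) h2
  -- The minimum at `t'` can be read off at some `ε ≤ ε₁`, where `G` no longer depends on `ε`.
  have hcount : ∀ t', t < t' → t' < t + (s₂ - t) → lineCount G t' = f := by
    intro t' h1 h2
    obtain ⟨ε₂, s₃, b0, b1, b2, b3, -⟩ := hG.stable (ht.trans h1)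
    have c1 := le_max_left s₃ t
    have c2 := le_max_right s₃ t
    have c3 : max s₃ t < t' := max_lt b2 h1
    have c4 := min_le_left ε₁ ε₂
    have c5 := min_le_right ε₁ ε₂
    have c6 : 0 < min ε₁ ε₂ := lt_min a0 b0
    rw [← b3 (min ε₁ ε₂) ((max s₃ t + t') / 2) c6 c5 (by linarith) (by linarith),
      a4 _ _ c6 c4 (by linarith)]
    exact hconst _ (by linarith) (by linarith)
  have hmid := hcount ((t + s₂) / 2) (by linarith) (by linarith)
  have hle : f ≤ lineCount G t := by
    rw [← hmid]
    exact lineCount_anti G ht (by linarith)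
  refine ⟨f, ?_, hle, ⟨s₂ - t, by linarith, hcount⟩, ?_, ?_⟩
  · rw [← hmid]
    exact hG.le_lineCount (by linarith)
  · obtain ⟨ε, e0, e1⟩ : ∃ ε : ℝ, 0 < ε ∧ ε < min ε₁ (min (t - s₁) (s₂ - t)) :=
      exists_between (lt_min a0 (lt_min (by linarith) (by linarith)))
    rw [lt_min_iff, lt_min_iff] at e1
    refine ⟨ε, e0, by linarith, ?_⟩
    rw [a3 ε (t - ε) e0 (by linarith) (by linarith) (by linarith),
      a4 ε (t + ε) e0 (by linarith) (by linarith), hconst _ (by linarith) (by linarith)]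
  -- By `super`, narrowing the strip from `ε` to `ε'` can only lower the difference, and for `ε' <
  -- ε₁` the subtracted term is at most `f`.
  · rintro n ⟨ε, e0, e1, rfl⟩
    obtain ⟨ε', g0, g1⟩ : ∃ ε' : ℝ, 0 < ε' ∧ ε' < min ε₁ ε := exists_between (lt_min a0 e0)
    rw [lt_min_iff] at g1
    have k1 := hG.super g0 g1.2.le (show ε < t - ε from e1) (show t - ε ≤ t + ε by linarith)
    have k2 : lineCount G t ≤ G ε' (t - ε) := lineCount_le G g0 (by linarith) (by linarith)
    have k3 : G ε' (t + ε) ≤ f := by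
      rw [a4 ε' _ g0 g1.1.le (by linarith)]
      exact le_csSup hbdd ⟨_, by linarith, rfl⟩
    omega

end IsLineFamily

/-! ### Enumerating and matching the bars of a line -/

/-- Two families over the same base with equivalent fibres are equivalent over the base. -/
lemma exists_equiv_of_fiber_equiv {A B Y : Type*} (f : A → Y) (g : B → Y)
    (h : ∀ y, Nonempty ({a // f a = y} ≃ {b // g b = y})) :
    ∃ e : A ≃ B, ∀ a, g (e a) = f a := by
  have h := fun y => (h y).some
  exact ⟨Equiv.ofFiberEquiv h, Equiv.ofFiberEquiv_map h⟩

/-- The pairs of a line `k` and the rank `n` of a bar of finite length on it. -/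
abbrev LineRank (G : ℝ → ℝ → ℝ → ℕ) (c : ℝ → ℕ) : Type :=
  {q : ℝ × ℕ // c q.1 ≤ q.2 ∧ ∃ t : ℝ, 0 < t ∧ q.2 < lineCount (G q.1) t}

/-- Enumeration by decreasing length of the bars `A` with endpoint `key` and length `len`. -/
lemma exists_line_enumeration {A : Type*} (key len : A → ℝ) (hlen : ∀ a, 0 < len a)
    (G : ℝ → ℝ → ℝ → ℕ) (c : ℝ → ℕ) (hG : ∀ k, IsLineFamily (G k) (c k))
    (hfin : ∀ k t, 0 < t → {a | key a = k ∧ len a = t}.Finite)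
    (hcard : ∀ k t, 0 < t →
      IsLeast {n : ℤ | ∃ ε : ℝ, 0 < ε ∧ ε < t - ε ∧
        n = (G k ε (t - ε) : ℤ) - (G k ε (t + ε) : ℤ)} ({a | key a = k ∧ len a = t}.ncard : ℤ)) :
    ∃ ρ : A → ℕ, (∀ a a', key a = key a' → ρ a = ρ a' → a = a') ∧
      ∀ k n t, 0 < t → ((∃ a, key a = k ∧ ρ a = n ∧ t ≤ len a) ↔
        c k ≤ n ∧ n < lineCount (G k) t) := by
  -- `T` is the length of the bar of rank `n`: the largest `t` whose count exceeds `n`. It is finite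
  -- because `c ≤ n`, and attained by left-continuity.
  have hT : ∀ q : LineRank G c,
      ∃ T : ℝ, 0 < T ∧ ∀ t, 0 < t → (q.1.2 < lineCount (G q.1.1) t ↔ t ≤ T) := by
    rintro ⟨⟨k, n⟩, hn, t₀, h0, h1⟩
    simp only at hn h1 ⊢
    obtain ⟨S, hS⟩ := (hG k).exists_lineCount_eq_of_lt
    have hb : BddAbove {t : ℝ | 0 < t ∧ n < lineCount (G k) t} := by
      refine ⟨S, ?_⟩
      rintro t ⟨-, ht⟩
      by_contra hlt
      rw [hS t (not_le.1 hlt)] at ht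
      omega
    set T := sSup {t : ℝ | 0 < t ∧ n < lineCount (G k) t} with hTdef
    have hT0 : 0 < T := h0.trans_le (le_csSup hb ⟨h0, h1⟩)
    refine ⟨T, hT0, fun t ht => ⟨fun h => le_csSup hb ⟨ht, h⟩, fun h => ?_⟩⟩
    have hmem : n < lineCount (G k) T := by
      obtain ⟨s, s0, s1, s2⟩ := lineCount_left (G k) hT0
      obtain ⟨t', ⟨u0, u1⟩, u2⟩ := exists_lt_of_lt_csSup
        (s := {t : ℝ | 0 < t ∧ n < lineCount (G k) t}) ⟨t₀, h0, h1⟩ s1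
      rw [← s2]
      exact u1.trans_le (lineCount_anti (G k) s0 u2.le)
    exact hmem.trans_le (lineCount_anti (G k) ht h)
  choose T hT0 hT using hT
  obtain ⟨e, he⟩ := exists_equiv_of_fiber_equiv (fun a => (key a, len a))
    (fun q : LineRank G c => (q.1.1, T q)) (by
      rintro ⟨k, t⟩
      by_cases ht : 0 < t
      swap
      · have : IsEmpty {a // (key a, len a) = (k, t)} := Subtype.isEmpty_of_false fun a ha => ht (by
          rw [← (Prod.mk.inj ha).2]; exact hlen a)
        have : IsEmpty {q : LineRank G c // (q.1.1, T q) = (k, t)} :=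
          Subtype.isEmpty_of_false fun a ha => ht (by
          rw [← (Prod.mk.inj ha).2]; exact hT0 a)
        exact ⟨Equiv.equivOfIsEmpty _ _⟩
      obtain ⟨f, hcf, hf, ⟨δ, hδ, hδf⟩, hleast⟩ := (hG k).exists_jump ht
      have e1 := (hcard k t ht).unique hleast
      -- The ranks with `T = t` are those counted at `t` but no longer just beyond it, where the
      -- count is `f`.
      have e2 : {q : LineRank G c // (q.1.1, T q) = (k, t)} ≃ Finset.Ico f (lineCount (G k) t) :=
        { toFun := fun q => ⟨q.1.1.2, by
            obtain ⟨⟨⟨k', n⟩, hn⟩, hq⟩ := q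
            obtain ⟨h1, h2⟩ := Prod.mk.inj hq
            simp only at h1
            subst h1
            have := hT ⟨(k', n), hn⟩
            rw [h2] at this
            simp only at this ⊢
            rw [Finset.mem_Ico]
            refine ⟨?_, (this t ht).2 le_rfl⟩
            by_contra hlt
            have h3 := (this (t + δ / 2) (by linarith)).1 (by
              rw [hδf _ (by linarith) (by linarith)]; omega)
            linarith⟩
          invFun := fun n => ⟨⟨(k, n.1), by
              have := Finset.mem_Ico.1 n.2
              exact ⟨by simp only; omega, t, ht, this.2⟩⟩, by
            have hn := Finset.mem_Ico.1 n.2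
            refine Prod.ext rfl ?_
            simp only
            generalize_proofs pf
            have h1 := hT ⟨(k, n.1), pf⟩
            have h0 := hT0 ⟨(k, n.1), pf⟩
            refine le_antisymm ?_ ((h1 t ht).1 hn.2)
            by_contra hlt
            rw [not_le] at hlt
            obtain ⟨t', g1, g2⟩ := exists_between (lt_min hlt (show t < t + δ by linarith))
            rw [lt_min_iff] at g2
            have h2 := (h1 t' (by linarith)).2 g2.1.le
            simp only at h2
            rw [hδf t' g1 g2.2] at h2
            omega⟩
          left_inv := by
            rintro ⟨⟨⟨k', n⟩, hn⟩, hq⟩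
            obtain ⟨h1, h2⟩ := Prod.mk.inj hq
            simp only at h1
            subst h1
            rfl
          right_inv := fun n => rfl }
      have hfin' : Finite {a // (key a, len a) = (k, t)} := by
        refine Set.Finite.to_subtype (s := {a | (key a, len a) = (k, t)}) ?_
        simpa only [Prod.mk.injEq] using hfin k t ht
      have : Finite {q : LineRank G c // (q.1.1, T q) = (k, t)} := Finite.of_equiv _ e2.symm
      refine Finite.card_eq.1 ?_
      rw [Nat.card_congr e2]
      have e3 : Nat.card {a // (key a, len a) = (k, t)} = {a | key a = k ∧ len a = t}.ncard := by
        rw [← Nat.card_coe_set_eq]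
        simp only [Prod.mk.injEq, Set.coe_ofPred]
      rw [e3, Nat.card_eq_fintype_card, Fintype.card_coe, Nat.card_Ico]
      omega)
  have hk : ∀ a, (e a).1.1 = key a := fun a => (Prod.mk.inj (he a)).1
  have hl : ∀ a, T (e a) = len a := fun a => (Prod.mk.inj (he a)).2
  refine ⟨fun a => (e a).1.2, fun a a' h1 h2 => ?_, fun k n t ht => ⟨?_, ?_⟩⟩
  · apply e.injective
    apply Subtype.ext
    exact Prod.ext (by rw [hk, hk, h1]) h2
  · rintro ⟨a, rfl, rfl, h⟩
    rw [← hl, ← hT _ _ ht] at h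
    have := (e a).2.1
    rw [hk] at h this
    exact ⟨this, h⟩
  · rintro ⟨h1, h2⟩
    have h3 : c (k, n).1 ≤ (k, n).2 ∧ ∃ t : ℝ, 0 < t ∧ (k, n).2 < lineCount (G (k, n).1) t :=
      ⟨h1, t, ht, h2⟩
    refine ⟨e.symm ⟨(k, n), h3⟩, ?_, ?_, ?_⟩
    · rw [← hk, Equiv.apply_symm_apply]
    · simp only [Equiv.apply_symm_apply]
    · rw [← hl, Equiv.apply_symm_apply, ← hT _ _ ht]
      exact h2

/-- Bars enumerated by decreasing length on each line are matched rank by rank. -/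
lemma exists_line_matching {A B : Type*} {keyA lenA : A → ℝ} {keyB lenB : B → ℝ}
    (hlenB : ∀ b, 0 < lenB b) {κ : ℝ → ℝ}
    (hκ : Function.Bijective κ) {ρA : A → ℕ} {ρB : B → ℕ} {N K : ℝ → ℝ → ℕ} {c : ℝ → ℕ} {w : ℝ}
    (hw : 0 ≤ w)
    (injA : ∀ a a', keyA a = keyA a' → ρA a = ρA a' → a = a')
    (injB : ∀ a a', keyB a = keyB a' → ρB a = ρB a' → a = a')
    (hA : ∀ k n t, 0 < t → ((∃ a, keyA a = κ k ∧ ρA a = n ∧ t ≤ lenA a) ↔ c k ≤ n ∧ n < N k t))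
    (hB : ∀ k n t, 0 < t → ((∃ b, keyB b = k ∧ ρB b = n ∧ t ≤ lenB b) ↔ c k ≤ n ∧ n < K k t))
    (hKN : ∀ k t, 0 < t → K k t ≤ N k t) (hNK : ∀ k t, 0 < t → N k (t + w) ≤ K k t) :
    ∃ j : B → A, Function.Injective j ∧ (∀ b, keyA (j b) = κ (keyB b)) ∧
      (∀ b, lenB b ≤ lenA (j b)) ∧ (∀ b, lenA (j b) ≤ lenB b + w) ∧
      ∀ a, (∀ b, j b ≠ a) → lenA a ≤ w := by
  -- `A` has at least as many bars of length `lenB b` on the corresponding line, so the rank of `b`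
  -- also occurs there.
  have h : ∀ b, ∃ a, keyA a = κ (keyB b) ∧ ρA a = ρB b ∧ lenB b ≤ lenA a := fun b => by
    rw [hA _ _ _ (hlenB b)]
    have := (hB (keyB b) (ρB b) (lenB b) (hlenB b)).1 ⟨b, rfl, rfl, le_rfl⟩
    exact ⟨this.1, this.2.trans_le (hKN _ _ (hlenB b))⟩
  choose j hj1 hj2 hj3 using h
  refine ⟨j, fun b b' hbb => ?_, hj1, hj3, fun b => ?_, fun a ha => ?_⟩
  · apply injB
    · apply hκ.1
      rw [← hj1, ← hj1, hbb]
    · rw [← hj2, ← hj2, hbb]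
  -- Otherwise `hNK` yields a bar of `B` of the same line and rank as `b`, hence `b` itself, of
  -- length at least `lenA (j b) - w`.
  · by_contra hlt
    rw [not_le] at hlt
    have hb := hlenB b
    have ht : 0 < lenA (j b) - w := by linarith
    have h1 := (hA (keyB b) (ρB b) (lenA (j b) - w + w) (by linarith)).1
      ⟨j b, hj1 b, hj2 b, by linarith⟩
    obtain ⟨b', g1, g2, g3⟩ := (hB _ _ _ ht).2 ⟨h1.1, h1.2.trans_le (hNK _ _ ht)⟩
    rw [injB _ _ g1 g2] at g3
    linarith
  -- An `a` longer than `w` has its rank realized in `B`, and the bar found there is sent to `a`.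
  · by_contra hlt
    rw [not_le] at hlt
    obtain ⟨k, hk⟩ := hκ.2 (keyA a)
    have ht : 0 < lenA a - w := by linarith
    have h1 := (hA k (ρA a) (lenA a - w + w) (by linarith)).1 ⟨a, hk.symm, rfl, by linarith⟩
    obtain ⟨b, g1, g2, g3⟩ := (hB _ _ _ ht).2 ⟨h1.1, h1.2.trans_le (hNK _ _ ht)⟩
    refine ha b (injA _ _ ?_ ?_)
    · rw [hj1, g1, hk]
    · rw [hj2, g2]

/-! ### Rank functions and their cornerpoints -/

/-- The formal properties of a reduced size function: `r x y`, for `x < y`, is monotone in `x`,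
antitone in `y`, has nonnegative alternating sums, vanishes for `x < m`, and is `1` when `m ≤ x`
and `y` is at least `C`. -/
structure IsRankFunction (r : ℝ → ℝ → ℕ) (m C : ℝ) : Prop where
  mono : ∀ ⦃x x' y : ℝ⦄, x ≤ x' → x' < y → r x y ≤ r x' y
  anti : ∀ ⦃x y y' : ℝ⦄, x < y → y ≤ y' → r x y' ≤ r x y
  super : ∀ ⦃x x' y y' : ℝ⦄, x ≤ x' → x' < y → y ≤ y' → r x y + r x' y' ≤ r x' y + r x y'
  zero : ∀ ⦃x y : ℝ⦄, x < m → x < y → r x y = 0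
  one : ∀ ⦃x y : ℝ⦄, m ≤ x → x < y → C ≤ y → r x y = 1

/-- The restriction of a function of two variables to the open half-plane. -/
def onDeltaPlus (r : ℝ → ℝ → ℕ) : DeltaPlus → ℕ := fun p => r p.1.1 p.1.2

/-- The line family of the vertical line of abscissa `b`. -/
def vertical (r : ℝ → ℝ → ℕ) (b ε s : ℝ) : ℕ := r (b + ε) (b + s) - r (b - ε) (b + s)

/-- The line family of the horizontal line of ordinate `d`. -/
def horizontal (r : ℝ → ℝ → ℕ) (d ε s : ℝ) : ℕ := r (d - s) (d - ε) - r (d - s) (d + ε)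

namespace IsRankFunction

variable {r : ℝ → ℝ → ℕ} {m C : ℝ}

-- This counts bars born in `(b - ε, b + ε]` that die after `b + s`. Widening `ε` adds two outer
-- strips, and `super` of `r` on each gives `super` here. The only bar that never dies is born at
-- `m`.
open Classical in
lemma isLineFamily_vertical (hr : IsRankFunction r m C) (b : ℝ) :
    IsLineFamily (vertical r b) (if b = m then 1 else 0) where
  mono ε ε' s h0 h1 h2 := by
    have a1 := hr.mono (show b + ε ≤ b + ε' by linarith) (show b + ε' < b + s by linarith)
    have a2 := hr.mono (show b - ε' ≤ b - ε by linarith) (show b - ε < b + s by linarith)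
    unfold vertical
    omega
  anti ε s s' h0 h1 h2 := by
    have a1 := hr.super (show b - ε ≤ b + ε by linarith) (show b + ε < b + s by linarith)
      (show b + s ≤ b + s' by linarith)
    unfold vertical
    omega
  super ε ε' s s' h0 h1 h2 h3 := by
    have a1 := hr.super (show b + ε ≤ b + ε' by linarith) (show b + ε' < b + s by linarith)
      (show b + s ≤ b + s' by linarith)
    have a2 := hr.super (show b - ε' ≤ b - ε by linarith) (show b - ε < b + s by linarith)
      (show b + s ≤ b + s' by linarith)
    have a3 := hr.mono (show b - ε ≤ b + ε by linarith) (show b + ε < b + s by linarith)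
    have a4 := hr.mono (show b - ε ≤ b + ε by linarith) (show b + ε < b + s' by linarith)
    have a5 := hr.mono (show b - ε' ≤ b + ε' by linarith) (show b + ε' < b + s by linarith)
    have a6 := hr.mono (show b - ε' ≤ b + ε' by linarith) (show b + ε' < b + s' by linarith)
    unfold vertical
    omega
  eventually_eq := by
    rcases lt_trichotomy b m with h | h | h
    · refine ⟨m - b, 0, by linarith, fun ε s h1 h2 h3 _ => ?_⟩
      rw [vertical, hr.zero (by linarith) (by linarith), if_neg h.ne, Nat.zero_sub]
    · refine ⟨1, C - b, by linarith, fun ε s h1 h2 h3 h4 => ?_⟩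
      rw [vertical, hr.one (by linarith) (by linarith) (by linarith),
        hr.zero (by linarith) (by linarith), if_pos h]
    · refine ⟨b - m, C - b, by linarith, fun ε s h1 h2 h3 h4 => ?_⟩
      rw [vertical, hr.one (by linarith) (by linarith) (by linarith),
        hr.one (by linarith) (by linarith) (by linarith), if_neg h.ne']

/-- The limiting count is `0` because `d - s` falls below `m` for large `s`: every bar with a finite
death has a bounded length. -/
lemma isLineFamily_horizontal (hr : IsRankFunction r m C) (d : ℝ) :
    IsLineFamily (horizontal r d) 0 where
  mono ε ε' s h0 h1 h2 := by
    have a1 := hr.anti (show d - s < d - ε' by linarith) (show d - ε' ≤ d - ε by linarith)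
    have a2 := hr.anti (show d - s < d + ε by linarith) (show d + ε ≤ d + ε' by linarith)
    unfold horizontal
    omega
  anti ε s s' h0 h1 h2 := by
    have a1 := hr.super (show d - s' ≤ d - s by linarith) (show d - s < d - ε by linarith)
      (show d - ε ≤ d + ε by linarith)
    unfold horizontal
    omega
  super ε ε' s s' h0 h1 h2 h3 := by
    have a1 := hr.super (show d - s' ≤ d - s by linarith) (show d - s < d - ε' by linarith)
      (show d - ε' ≤ d - ε by linarith)
    have a2 := hr.super (show d - s' ≤ d - s by linarith) (show d - s < d + ε by linarith)
      (show d + ε ≤ d + ε' by linarith)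
    have a3 := hr.anti (show d - s < d - ε by linarith) (show d - ε ≤ d + ε by linarith)
    have a4 := hr.anti (show d - s' < d - ε by linarith) (show d - ε ≤ d + ε by linarith)
    have a5 := hr.anti (show d - s < d - ε' by linarith) (show d - ε' ≤ d + ε' by linarith)
    have a6 := hr.anti (show d - s' < d - ε' by linarith) (show d - ε' ≤ d + ε' by linarith)
    unfold horizontal
    omega
  eventually_eq := by
    refine ⟨1, d - m, one_pos, fun ε s h1 h2 h3 h4 => ?_⟩
    rw [horizontal, hr.zero (by linarith) (by linarith), Nat.zero_sub]

/-- The difference of the line family across `t` is the alternating sum in `multiplicity`, grouped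
by ordinate; monotonicity makes the natural subtractions exact. By `exists_jump` the infimum is
attained. -/
lemma isLeast_vertical (hr : IsRankFunction r m C) (p : DeltaPlus) {b t : ℝ}
    (hb : p.1.1 = b) (ht : p.1.2 - p.1.1 = t) :
    IsLeast {n : ℤ | ∃ ε : ℝ, 0 < ε ∧ ε < t - ε ∧
      n = (vertical r b ε (t - ε) : ℤ) - (vertical r b ε (t + ε) : ℤ)}
      (multiplicity (onDeltaPlus r) p) := by
  obtain ⟨⟨x, y⟩, hxy⟩ := p
  simp only at hb ht hxy
  subst hb ht
  have ht : 0 < y - x := by linarith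
  obtain ⟨f, -, -, -, hl⟩ := (hr.isLineFamily_vertical x).exists_jump ht
  convert hl using 1
  rw [← hl.csInf_eq, multiplicity]
  congr 1
  ext n
  refine exists_congr fun ε => ⟨?_, ?_⟩
  · rintro ⟨h0, h1, rfl⟩
    simp only at h1
    refine ⟨h0, by linarith, ?_⟩
    have a1 := hr.mono (show x - ε ≤ x + ε by linarith) (show x + ε < y - ε by linarith)
    have a2 := hr.mono (show x - ε ≤ x + ε by linarith) (show x + ε < y + ε by linarith)
    simp only [onDeltaPlus, vertical]
    rw [show x + (y - x - ε) = y - ε by ring, show x + (y - x + ε) = y + ε by ring]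
    omega
  · rintro ⟨h0, h1, rfl⟩
    refine ⟨h0, by simp only; linarith, ?_⟩
    have a1 := hr.mono (show x - ε ≤ x + ε by linarith) (show x + ε < y - ε by linarith)
    have a2 := hr.mono (show x - ε ≤ x + ε by linarith) (show x + ε < y + ε by linarith)
    simp only [onDeltaPlus, vertical]
    rw [show x + (y - x - ε) = y - ε by ring, show x + (y - x + ε) = y + ε by ring]
    omega

/-- The same alternating sum, grouped by abscissa. -/
lemma isLeast_horizontal (hr : IsRankFunction r m C) (p : DeltaPlus) {d t : ℝ}
    (hd : p.1.2 = d) (ht : p.1.2 - p.1.1 = t) :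
    IsLeast {n : ℤ | ∃ ε : ℝ, 0 < ε ∧ ε < t - ε ∧
      n = (horizontal r d ε (t - ε) : ℤ) - (horizontal r d ε (t + ε) : ℤ)}
      (multiplicity (onDeltaPlus r) p) := by
  have hl := hr.isLeast_vertical p rfl rfl
  obtain ⟨⟨x, y⟩, hxy⟩ := p
  simp only at hd ht hxy hl
  subst hd ht
  convert hl using 1
  ext n
  refine exists_congr fun ε => and_congr_right fun h0 => and_congr_right fun h1 => ?_
  have a1 := hr.mono (show x - ε ≤ x + ε by linarith) (show x + ε < y - ε by linarith)
  have a2 := hr.mono (show x - ε ≤ x + ε by linarith) (show x + ε < y + ε by linarith)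
  have a3 := hr.anti (show x - ε < y - ε by linarith) (show y - ε ≤ y + ε by linarith)
  have a4 := hr.anti (show x + ε < y - ε by linarith) (show y - ε ≤ y + ε by linarith)
  simp only [horizontal, vertical]
  rw [show x + (y - x - ε) = y - ε by ring, show x + (y - x + ε) = y + ε by ring,
    show y - (y - x - ε) = x + ε by ring, show y - (y - x + ε) = x - ε by ring]
  omega

lemma multiplicity_nonneg (hr : IsRankFunction r m C) (p : DeltaPlus) :
    0 ≤ multiplicity (onDeltaPlus r) p := by
  have ht : 0 < p.1.2 - p.1.1 := by linarith [p.2]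
  obtain ⟨f, -, h1, -, hl⟩ := (hr.isLineFamily_vertical p.1.1).exists_jump ht
  rw [(hr.isLeast_vertical p rfl rfl).unique hl]
  omega

lemma isCornerpointAtInfinity_iff (hr : IsRankFunction r m C) (k : ℝ) :
    IsCornerpointAtInfinity (onDeltaPlus r) k ↔ k = m := by
  -- For `ε` small, `1 / ε` exceeds both `k + ε` and `C`, so `r` is known there to be `0` or `1`.
  have hε : ∀ z : ℝ, 0 < z → ∃ ε : ℝ, 0 < ε ∧ ε < z ∧ k + ε < 1 / ε ∧ C ≤ 1 / ε := by
    intro z hz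
    have h1 : 0 < |k| + |C| + 2 := by positivity
    have h2 : 0 < 1 / (|k| + |C| + 2) := by positivity
    obtain ⟨ε, e0, e1⟩ := exists_between (lt_min hz h2)
    rw [lt_min_iff] at e1
    have h3 : |k| + |C| + 2 < 1 / ε := by
      rw [lt_div_iff₀ h1] at e1
      rw [lt_div_iff₀ e0]
      linarith [e1.2]
    have h4 : ε < 1 := by
      refine e1.2.trans ?_
      rw [div_lt_one h1]
      linarith [abs_nonneg k, abs_nonneg C]
    refine ⟨ε, e0, e1.1, ?_, ?_⟩
    · linarith [le_abs_self k, abs_nonneg C]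
    · linarith [le_abs_self C, abs_nonneg k]
  rw [IsCornerpointAtInfinity, multiplicityAtInfinity]
  constructor
  · intro hpos
    by_contra hne
    obtain ⟨ε, e0, e1, e2, e3⟩ := hε |k - m| (abs_pos.2 (sub_ne_zero.2 hne))
    -- The bound `0` from below is needed for the integer infimum to be a genuine one.
    refine absurd hpos (not_lt.2 (csInf_le ⟨0, ?_⟩ ⟨ε, e0, e2, ?_⟩))
    · rintro n ⟨δ, d0, d1, rfl⟩
      have := hr.mono (show k - δ ≤ k + δ by linarith) d1
      simp only [onDeltaPlus]
      omega
    · simp only [onDeltaPlus]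
      rcases lt_or_gt_of_ne hne with h | h
      · rw [abs_of_neg (by linarith)] at e1
        rw [hr.zero (by linarith) e2, hr.zero (by linarith) (by linarith)]
        rfl
      · rw [abs_of_pos (by linarith)] at e1
        rw [hr.one (by linarith) e2 e3, hr.one (by linarith) (by linarith) e3]
        rfl
  · rintro rfl
    refine Int.lt_of_lt_of_le zero_lt_one (le_csInf ?_ ?_)
    · obtain ⟨ε, e0, -, e2, -⟩ := hε 1 one_pos
      exact ⟨_, ε, e0, e2, rfl⟩
    · rintro n ⟨ε, e0, e1, rfl⟩
      simp only [onDeltaPlus]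
      -- Here `1 / ε` may be below `C`; raising the ordinate to at least `C` only lowers `r`, to the
      -- value `1`.
      have h1 := hr.anti e1 (le_max_right C (1 / ε))
      rw [hr.one (by linarith) (e1.trans_le (le_max_right _ _)) (le_max_left _ _)] at h1
      have h2 : r (k - ε) (1 / ε) = 0 := hr.zero (by linarith) (by linarith)
      omega

end IsRankFunction

/-! ### Barcodes and the matching through an intermediate barcode -/

/-- `pos` lists the proper cornerpoints of `l`, each as often as its multiplicity says. -/
def IsBarcode {A : Type*} (l : DeltaPlus → ℕ) (pos : A → DeltaPlus) : Prop :=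
  ∀ p, {a | pos a = p}.Finite ∧ ({a | pos a = p}.ncard : ℤ) = multiplicity l p

/-- The proper cornerpoints of `l`, repeated according to multiplicity. -/
abbrev Bars (l : DeltaPlus → ℕ) : Type := Σ p : DeltaPlus, Fin (multiplicity l p).toNat

lemma isBarcode_bars {l : DeltaPlus → ℕ} (hl : ∀ p, 0 ≤ multiplicity l p) :
    IsBarcode l (fun a : Bars l => a.1) := by
  intro p
  have e : {a : Bars l | a.1 = p} ≃ Fin (multiplicity l p).toNat := Equiv.sigmaSubtype p
  refine ⟨Set.finite_coe_iff.1 (Finite.of_equiv _ e.symm), ?_⟩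
  rw [← Nat.card_coe_set_eq, Nat.card_congr e, Nat.card_fin]
  exact Int.toNat_of_nonneg (hl p)

/-- The pointwise comparisons `hHG` and `hGH` pass to `lineCount`, a minimum over `ε < s < t`, with
the same shift `w`. The condition `hc` makes the ranks of finite bars start at the same number on
corresponding lines. -/
lemma exists_bar_matching {A B : Type*} {keyA lenA : A → ℝ} {keyB lenB : B → ℝ}
    (hlenA : ∀ a, 0 < lenA a) (hlenB : ∀ b, 0 < lenB b) {κ : ℝ → ℝ} (hκ : Function.Bijective κ)
    {G H : ℝ → ℝ → ℝ → ℕ} {c c' : ℝ → ℕ} {w : ℝ} (hw : 0 ≤ w)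
    (hG : ∀ k, IsLineFamily (G k) (c k)) (hH : ∀ k, IsLineFamily (H k) (c' k))
    (hc : ∀ k, c (κ k) = c' k)
    (finA : ∀ k t, 0 < t → {a | keyA a = k ∧ lenA a = t}.Finite)
    (cardA : ∀ k t, 0 < t →
      IsLeast {n : ℤ | ∃ ε : ℝ, 0 < ε ∧ ε < t - ε ∧
        n = (G k ε (t - ε) : ℤ) - (G k ε (t + ε) : ℤ)} ({a | keyA a = k ∧ lenA a = t}.ncard : ℤ))
    (finB : ∀ k t, 0 < t → {a | keyB a = k ∧ lenB a = t}.Finite)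
    (cardB : ∀ k t, 0 < t →
      IsLeast {n : ℤ | ∃ ε : ℝ, 0 < ε ∧ ε < t - ε ∧
        n = (H k ε (t - ε) : ℤ) - (H k ε (t + ε) : ℤ)} ({a | keyB a = k ∧ lenB a = t}.ncard : ℤ))
    (hHG : ∀ k ε s, 0 < ε → ε < s → H k ε s ≤ G (κ k) ε s)
    (hGH : ∀ k ε s, 0 < ε → ε < s → G (κ k) ε (s + w) ≤ H k ε s) :
    ∃ j : B → A, Function.Injective j ∧ (∀ b, keyA (j b) = κ (keyB b)) ∧
      (∀ b, lenB b ≤ lenA (j b)) ∧ (∀ b, lenA (j b) ≤ lenB b + w) ∧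
      ∀ a, (∀ b, j b ≠ a) → lenA a ≤ w := by
  obtain ⟨ρA, injA, hA⟩ := exists_line_enumeration keyA lenA hlenA G c hG finA cardA
  obtain ⟨ρB, injB, hB⟩ := exists_line_enumeration keyB lenB hlenB H c' hH finB cardB
  refine exists_line_matching (N := fun k => lineCount (G (κ k))) (K := fun k => lineCount (H k))
    (c := c') hlenB hκ hw injA injB (fun k n t ht => ?_) hB (fun k t ht => ?_) (fun k t ht => ?_)
  · rw [hA _ _ _ ht, hc]
  · obtain ⟨ε, s, h0, h1, h2, e⟩ := exists_lineCount_eq (G (κ k)) ht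
    simp only [e]
    exact (lineCount_le _ h0 h1 h2).trans (hHG k ε s h0 h1)
  · obtain ⟨ε, s, h0, h1, h2, e⟩ := exists_lineCount_eq (H k) ht
    simp only [e]
    exact (lineCount_le _ h0 (by linarith) (by linarith)).trans (hGH k ε s h0 h1)

lemma IsBarcode.on_vertical_line {A : Type*} {pos : A → DeltaPlus} {r : ℝ → ℝ → ℕ} {m C : ℝ}
    (hA : IsBarcode (onDeltaPlus r) pos) (hr : IsRankFunction r m C) (k t : ℝ) (ht : 0 < t) :
    {a | (pos a).1.1 = k ∧ (pos a).1.2 - (pos a).1.1 = t}.Finite ∧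
      IsLeast {n : ℤ | ∃ ε : ℝ, 0 < ε ∧ ε < t - ε ∧
        n = (vertical r k ε (t - ε) : ℤ) - (vertical r k ε (t + ε) : ℤ)}
        ({a | (pos a).1.1 = k ∧ (pos a).1.2 - (pos a).1.1 = t}.ncard : ℤ) := by
  have e : {a | (pos a).1.1 = k ∧ (pos a).1.2 - (pos a).1.1 = t} =
      {a | pos a = ⟨(k, k + t), by simp only; linarith⟩} := by
    ext a
    simp only [Set.mem_ofPred_eq, Subtype.ext_iff, Prod.ext_iff]
    exact ⟨fun h => ⟨h.1, by linarith⟩, fun h => ⟨h.1, by linarith⟩⟩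
  rw [e]
  refine ⟨(hA _).1, ?_⟩
  rw [(hA _).2]
  exact hr.isLeast_vertical _ rfl (by simp only; ring)

lemma IsBarcode.on_horizontal_line {A : Type*} {pos : A → DeltaPlus} {r : ℝ → ℝ → ℕ} {m C : ℝ}
    (hA : IsBarcode (onDeltaPlus r) pos) (hr : IsRankFunction r m C) (k t : ℝ) (ht : 0 < t) :
    {a | (pos a).1.2 = k ∧ (pos a).1.2 - (pos a).1.1 = t}.Finite ∧
      IsLeast {n : ℤ | ∃ ε : ℝ, 0 < ε ∧ ε < t - ε ∧
        n = (horizontal r k ε (t - ε) : ℤ) - (horizontal r k ε (t + ε) : ℤ)}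
        ({a | (pos a).1.2 = k ∧ (pos a).1.2 - (pos a).1.1 = t}.ncard : ℤ) := by
  have e : {a | (pos a).1.2 = k ∧ (pos a).1.2 - (pos a).1.1 = t} =
      {a | pos a = ⟨(k - t, k), by simp only; linarith⟩} := by
    ext a
    simp only [Set.mem_ofPred_eq, Subtype.ext_iff, Prod.ext_iff]
    exact ⟨fun h => ⟨by linarith, by linarith⟩, fun h => ⟨by linarith, by linarith⟩⟩
  rw [e]
  refine ⟨(hA _).1, ?_⟩
  rw [(hA _).2]
  exact hr.isLeast_horizontal _ rfl (by simp only; ring)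

/-- Bars of the image of an interleaving map inject into the bars of the source, with the same
birth, and into the bars of the target, with the same death up to the shift. -/
theorem exists_barcode_matching {A B : Type*} {posA : A → DeltaPlus} {posB : B → DeltaPlus}
    {V R W : ℝ → ℝ → ℕ} {m C C' m' C'' h : ℝ} (hh : 0 ≤ h)
    (hV : IsRankFunction V m C) (hR : IsRankFunction R m C') (hW : IsRankFunction W m' C'')
    (hA : IsBarcode (onDeltaPlus V) posA) (hB : IsBarcode (onDeltaPlus W) posB)
    (hRV : ∀ x x' y, x ≤ x' → x' < y → V x y + R x' y ≤ V x' y + R x y)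
    (hVR : ∀ x x' y, x ≤ x' → x' < y → R x y + V x' (y + 2 * h) ≤ R x' y + V x (y + 2 * h))
    (hRW : ∀ x y y', x < y → y ≤ y' → R x y + W (x + h) (y' + h) ≤ R x y' + W (x + h) (y + h))
    (hWR : ∀ x y y', x < y → y ≤ y' → W (x - h) (y + h) + R x y' ≤ W (x - h) (y' + h) + R x y) :
    ∃ (ι : Type) (f : ι → A) (g : ι → B), Function.Injective f ∧ Function.Injective g ∧
      (∀ i, |(posA (f i)).1.1 - (posB (g i)).1.1| ≤ h ∧
        |(posA (f i)).1.2 - (posB (g i)).1.2| ≤ h) ∧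
      (∀ a, (∀ i, f i ≠ a) → (posA a).1.2 - (posA a).1.1 ≤ 2 * h) ∧
      (∀ b, (∀ i, g i ≠ b) → (posB b).1.2 - (posB b).1.1 ≤ 2 * h) := by
  classical
  have hD := isBarcode_bars hR.multiplicity_nonneg
  have hw : 0 ≤ 2 * h := by linarith
  -- `V` and `R` share `m`, so their infinite bars occupy the same rank of the same vertical line.
  obtain ⟨f, f1, f2, f3, f4, f5⟩ := exists_bar_matching (κ := id) (G := vertical V)
    (H := vertical R) (fun a => sub_pos.2 (posA a).2)
    (fun i : Bars (onDeltaPlus R) => sub_pos.2 i.1.2) Function.bijective_id hw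
    hV.isLineFamily_vertical hR.isLineFamily_vertical (fun k => rfl)
    (fun k t ht => (hA.on_vertical_line hV k t ht).1)
    (fun k t ht => (hA.on_vertical_line hV k t ht).2)
    (fun k t ht => (hD.on_vertical_line hR k t ht).1)
    (fun k t ht => (hD.on_vertical_line hR k t ht).2)
    (fun k ε s h0 h1 => by
      have := hRV (k - ε) (k + ε) (k + s) (by linarith) (by linarith)
      simp only [vertical, id]
      omega)
    (fun k ε s h0 h1 => by
      have := hVR (k - ε) (k + ε) (k + s) (by linarith) (by linarith)
      simp only [vertical, id, ← add_assoc]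
      omega)
  obtain ⟨g, g1, g2, g3, g4, g5⟩ := exists_bar_matching (κ := fun k => k + h)
    (G := horizontal W) (H := horizontal R) (fun a => sub_pos.2 (posB a).2)
    (fun i : Bars (onDeltaPlus R) => sub_pos.2 i.1.2) (AddGroup.addRight_bijective h) hw
    hW.isLineFamily_horizontal hR.isLineFamily_horizontal (fun k => rfl)
    (fun k t ht => (hB.on_horizontal_line hW k t ht).1)
    (fun k t ht => (hB.on_horizontal_line hW k t ht).2)
    (fun k t ht => (hD.on_horizontal_line hR k t ht).1)
    (fun k t ht => (hD.on_horizontal_line hR k t ht).2)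
    (fun k ε s h0 h1 => by
      have := hRW (k - s) (k - ε) (k + ε) (by linarith) (by linarith)
      simp only [horizontal]
      rw [show k + h - s = k - s + h by ring, show k + h - ε = k - ε + h by ring,
        show k + h + ε = k + ε + h by ring]
      omega)
    (fun k ε s h0 h1 => by
      have := hWR (k - s) (k - ε) (k + ε) (by linarith) (by linarith)
      simp only [horizontal]
      rw [show k + h - (s + 2 * h) = k - s - h by ring, show k + h - ε = k - ε + h by ring,
        show k + h + ε = k + ε + h by ring]
      omega)
  refine ⟨_, f, g, f1, g1, fun i => ?_, f5, g5⟩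
  -- For a bar `(b, d)` of `R`, the bar of `V` is `(b, d')` with `d ≤ d' ≤ d + 2h`, and the bar of
  -- `W` is `(b', d + h)` with `b - h ≤ b' ≤ b + h`.
  have a2 := f2 i
  have a3 := f3 i
  have a4 := f4 i
  have b2 := g2 i
  have b3 := g3 i
  have b4 := g4 i
  simp only [id] at a2
  rw [abs_le, abs_le]
  refine ⟨⟨?_, ?_⟩, ?_, ?_⟩ <;> linarith

/-! ### Components of level sets -/

/-- If `g` factors through `f`, then `g` takes at most as many new values as `f` on the larger of
two sets. -/
lemma ncard_image_add_le {α β γ : Type*} {f : α → β} {g : α → γ} {A A' : Set α} (hA : A ⊆ A')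
    (hfin : (f '' A').Finite) (hfg : ∀ a ∈ A', ∀ b ∈ A', f a = f b → g a = g b) :
    (f '' A).ncard + (g '' A').ncard ≤ (f '' A').ncard + (g '' A).ncard := by
  rcases A'.eq_empty_or_nonempty with rfl | ⟨a₀, -⟩
  · simp [Set.subset_empty_iff.1 hA]
  have hpick : ∀ c, ∃ a, c ∈ g '' A' → a ∈ A' ∧ g a = c := fun c => by
    by_cases hc : c ∈ g '' A'
    · obtain ⟨a, ha⟩ := hc
      exact ⟨a, fun _ => ha⟩
    · exact ⟨a₀, fun h => absurd h hc⟩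
  choose k hk using hpick
  have hinj : Set.InjOn (fun c => f (k c)) (g '' A') := fun c hc d hd h => by
    rw [← (hk c hc).2, ← (hk d hd).2]
    exact hfg _ (hk c hc).1 _ (hk d hd).1 h
  have hfin' : (g '' A').Finite :=
    Set.Finite.of_injOn (t := f '' A') (fun c hc => ⟨k c, (hk c hc).1, rfl⟩) hinj hfin
  have hF : f '' A ⊆ f '' A' := Set.image_mono hA
  have hG : g '' A ⊆ g '' A' := Set.image_mono hA
  have h1 := Set.ncard_sdiff_add_ncard_of_subset hF hfin
  have h2 := Set.ncard_sdiff_add_ncard_of_subset hG hfin'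
  -- With a section `k` of `g`, each new value `c` of `g` gives a value `f (k c)` that is new for
  -- `f`, since `g` is determined by `f`.
  have h3 : (g '' A' \ g '' A).ncard ≤ (f '' A' \ f '' A).ncard := by
    refine Set.ncard_le_ncard_of_injOn (fun c => f (k c)) (fun c hc => ?_)
      (hinj.mono Set.sdiff_subset) hfin.sdiff
    refine ⟨⟨k c, (hk c hc.1).1, rfl⟩, ?_⟩
    rintro ⟨a, ha, e⟩
    exact hc.2 ⟨a, ha, by rw [hfg a (hA ha) _ (hk c hc.1).1 e, (hk c hc.1).2]⟩
  omega

/-- The number of components of `{ψ ≤ y}` that meet `{φ ≤ x}`. -/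
noncomputable def pairRank {M : Type*} [TopologicalSpace M] (φ ψ : M → ℝ) (x y : ℝ) : ℕ :=
  (connectedComponentIn (lowerLevel ψ y) '' lowerLevel φ x).ncard

lemma lowerLevel_subset {M : Type*} {φ ψ : M → ℝ} {x y h : ℝ} (H : ∀ P, ψ P ≤ φ P + h) (hxy : x + h ≤ y) :
    lowerLevel φ x ⊆ lowerLevel ψ y := fun P hP => by
  have h1 : φ P ≤ x := hP
  exact show ψ P ≤ y by linarith [H P]

section

variable {M : Type*} [TopologicalSpace M]

lemma connectedComponentIn_eq_of_subset {B B' : Set M} (hB : B ⊆ B') {P Q : M}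
    (hQ : Q ∈ B) (h : connectedComponentIn B P = connectedComponentIn B Q) :
    connectedComponentIn B' P = connectedComponentIn B' Q := by
  have h1 : Q ∈ connectedComponentIn B P := h ▸ mem_connectedComponentIn hQ
  exact connectedComponentIn_eq (connectedComponentIn_mono P hB h1)

/-- The relation is the kernel of the map from a point to its component in the level set at `y`, so
classes correspond to components met. -/
lemma reducedSizeFunction_eq (φ : M → ℝ) : reducedSizeFunction φ = onDeltaPlus (pairRank φ φ) := by
  funext p
  obtain ⟨⟨x, y⟩, hxy⟩ := p
  simp only [reducedSizeFunction, onDeltaPlus, pairRank]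
  rw [← Nat.card_coe_set_eq, Set.image_eq_range]
  have hxy' : x ≤ y := le_of_lt hxy
  have hs : levelSetoid φ x y hxy' =
      Setoid.ker (fun P : lowerLevel φ x => connectedComponentIn (lowerLevel φ y) (P : M)) := by
    ext P Q
    have hP : (P : M) ∈ lowerLevel φ y := le_trans (show φ P ≤ x from P.2) hxy'
    have hQ : (Q : M) ∈ lowerLevel φ y := le_trans (show φ Q ≤ x from Q.2) hxy'
    rw [Setoid.ker_def]
    constructor
    · rintro ⟨C, hC, hc, h1, h2⟩
      exact connectedComponentIn_eq (hc.isPreconnected.subset_connectedComponentIn h1 hC h2)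
    · intro h
      exact ⟨_, connectedComponentIn_subset _ (P : M), isConnected_connectedComponentIn_iff.2 hP,
        mem_connectedComponentIn hP, h ▸ mem_connectedComponentIn hQ⟩
  rw [hs]
  exact Nat.card_congr (Setoid.quotientKerEquivRange _)

/-- Components of the open set `{φ < y - h}` are open by local connectedness. Finitely many cover
the compact set `{φ ≤ x}`, and each lies in one component of `{ψ ≤ y}`. -/
lemma finite_components [CompactSpace M] [LocallyConnectedSpace M] {φ ψ : M → ℝ}
    (hφ : Continuous φ) {x y h : ℝ} (H : ∀ P, ψ P ≤ φ P + h) (hxy : x + h < y) :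
    (connectedComponentIn (lowerLevel ψ y) '' lowerLevel φ x).Finite := by
  have hU : IsOpen {P | φ P < y - h} := isOpen_lt hφ continuous_const
  have hUB : {P | φ P < y - h} ⊆ lowerLevel ψ y := fun P hP => by
    have h1 : φ P < y - h := hP
    exact show ψ P ≤ y by linarith [H P]
  have hAU : lowerLevel φ x ⊆ {P | φ P < y - h} := fun P hP => by
    have h1 : φ P ≤ x := hP
    exact show φ P < y - h by linarith
  have hK : IsCompact (lowerLevel φ x) := (isClosed_le hφ continuous_const).isCompact
  obtain ⟨t, ht, hcov⟩ := hK.elim_nhds_subcover (connectedComponentIn {P | φ P < y - h})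
    fun P hP => hU.connectedComponentIn.mem_nhds (mem_connectedComponentIn (hAU hP))
  refine (t.finite_toSet.image (connectedComponentIn (lowerLevel ψ y))).subset ?_
  rintro _ ⟨P, hP, rfl⟩
  obtain ⟨Q, hQ, hPQ⟩ := Set.mem_iUnion₂.1 (hcov hP)
  exact ⟨Q, hQ, connectedComponentIn_eq (connectedComponentIn_mono Q hUB hPQ)⟩

/-- The basic inequality: enlarging the upper level set decreases the number of components that
become visible when the lower level set is enlarged. -/
lemma pairRank_add_le [CompactSpace M] [LocallyConnectedSpace M] {φ ψ φ' ψ' : M → ℝ}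
    (hφ' : Continuous φ') {x x' y y' h : ℝ} (hA : lowerLevel φ x ⊆ lowerLevel φ' x')
    (H : ∀ P, ψ P ≤ φ' P + h) (hxy : x' + h < y) (hB : lowerLevel ψ y ⊆ lowerLevel ψ' y') :
    pairRank φ ψ x y + pairRank φ' ψ' x' y' ≤ pairRank φ' ψ x' y + pairRank φ ψ' x y' :=
  ncard_image_add_le hA (finite_components hφ' H hxy) fun _ _ _ hQ h =>
    connectedComponentIn_eq_of_subset hB (lowerLevel_subset H hxy.le hQ) h

lemma isRankFunction_pairRank [CompactSpace M] [ConnectedSpace M] [LocallyConnectedSpace M]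
    {φ ψ : M → ℝ} (hφ : Continuous φ) (hψ : Continuous ψ) {h : ℝ} (H : ∀ P, ψ P ≤ φ P + h) :
    ∃ C, IsRankFunction (fun x y => pairRank φ ψ x (y + h)) (⨅ P, φ P) C := by
  obtain ⟨C, hC⟩ := (isCompact_range hψ).bddAbove
  obtain ⟨P₀, hP₀⟩ : ∃ P₀, φ P₀ = ⨅ P, φ P := by
    obtain ⟨P₀, -, h1⟩ := isCompact_univ.exists_isMinOn Set.univ_nonempty hφ.continuousOn
    exact ⟨P₀, le_antisymm (le_ciInf fun P => h1 (Set.mem_univ P))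
      (ciInf_le (isCompact_range hφ).bddBelow P₀)⟩
  have mono : ∀ ⦃x x' : ℝ⦄, x ≤ x' → lowerLevel φ x ⊆ lowerLevel φ x' :=
    fun x x' hx P (hP : φ P ≤ x) => hP.trans hx
  have mono' : ∀ ⦃x x' : ℝ⦄, x ≤ x' → lowerLevel ψ x ⊆ lowerLevel ψ x' :=
    fun x x' hx P (hP : ψ P ≤ x) => hP.trans hx
  refine ⟨C - h, fun x x' y h1 h2 => ?_, fun x y y' h1 h2 => ?_, fun x x' y y' h1 h2 h3 => ?_,
    fun x y h1 h2 => ?_, fun x y h1 h2 h3 => ?_⟩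
  · exact Set.ncard_le_ncard (Set.image_mono (mono h1)) (finite_components hφ H (by linarith))
  -- With the empty set as the smaller set, the counting inequality is monotonicity under
  -- coarsening.
  · have h4 := ncard_image_add_le (Set.empty_subset (lowerLevel φ x))
      (finite_components hφ H (show x + h < y + h by linarith))
      (g := connectedComponentIn (lowerLevel ψ (y' + h))) fun _ _ _ hQ h =>
        connectedComponentIn_eq_of_subset (mono' (by linarith))
          (lowerLevel_subset H (by linarith) hQ) h
    simp only [Set.image_empty, Set.ncard_empty, zero_add, add_zero] at h4
    exact h4
  · exact pairRank_add_le hφ (mono h1) H (by linarith) (mono' (by linarith))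
  · have : lowerLevel φ x = ∅ := Set.eq_empty_of_forall_notMem fun P (hP : φ P ≤ x) =>
      absurd (ciInf_le (isCompact_range hφ).bddBelow P) (by linarith)
    rw [pairRank, this, Set.image_empty, Set.ncard_empty]
  · have : lowerLevel ψ (y + h) = Set.univ := Set.eq_univ_of_forall fun P =>
      show ψ P ≤ y + h by linarith [hC ⟨P, rfl⟩]
    have h4 : P₀ ∈ lowerLevel φ x := hP₀.le.trans h1
    rw [pairRank, this, Set.ncard_eq_one]
    refine ⟨Set.univ, ?_⟩
    have h5 : ∀ P : M, connectedComponentIn Set.univ P = Set.univ := fun P => by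
      rw [connectedComponentIn_univ, PreconnectedSpace.connectedComponent_eq_univ]
    simp only [h5]
    exact Set.Nonempty.image_const ⟨P₀, h4⟩ _

lemma isRankFunction_self [CompactSpace M] [ConnectedSpace M] [LocallyConnectedSpace M]
    {φ : M → ℝ} (hφ : Continuous φ) : ∃ C, IsRankFunction (pairRank φ φ) (⨅ P, φ P) C := by
  simpa only [add_zero] using
    isRankFunction_pairRank hφ hφ (h := 0) (fun P => (add_zero (φ P)).ge)

lemma reducedSizeFunction_comp_homeomorph {N : Type*} [TopologicalSpace N] (h : M ≃ₜ N)
    (ψ : N → ℝ) : reducedSizeFunction (ψ ∘ h) = reducedSizeFunction ψ := by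
  funext p
  refine Nat.card_congr (Quotient.congr
    (h.toEquiv.subtypeEquiv (p := (· ∈ lowerLevel (ψ ∘ h) p.1.1)) fun P => Iff.rfl) fun P Q => ?_)
  constructor
  · rintro ⟨C, hC, hc, h1, h2⟩
    refine ⟨h '' C, ?_, hc.image _ h.continuous.continuousOn, ⟨P, h1, rfl⟩, ⟨Q, h2, rfl⟩⟩
    rintro _ ⟨R, hR, rfl⟩
    exact hC hR
  · rintro ⟨C, hC, hc, h1, h2⟩
    refine ⟨h ⁻¹' C, fun R hR => hC hR, ?_, h1, h2⟩
    rw [← h.image_symm]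
    exact hc.image _ h.symm.continuous.continuousOn

end

/-- Barcodes of reduced size functions of functions on the same space at uniform distance at most
`h` admit a partial matching that moves the coordinates by at most `h` and leaves out only bars
of length at most `2 * h`. -/
theorem exists_barcode_matching_of_abs_sub_le {M : Type*} [TopologicalSpace M] [CompactSpace M]
    [ConnectedSpace M] [LocallyConnectedSpace M] {φ ψ : M → ℝ} (hφ : Continuous φ)
    (hψ : Continuous ψ) {h : ℝ} (H : ∀ P, |φ P - ψ P| ≤ h)
    {A B : Type*} {posA : A → DeltaPlus} {posB : B → DeltaPlus}
    (hA : IsBarcode (reducedSizeFunction φ) posA) (hB : IsBarcode (reducedSizeFunction ψ) posB) :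
    ∃ (ι : Type) (f : ι → A) (g : ι → B), Function.Injective f ∧ Function.Injective g ∧
      (∀ i, |(posA (f i)).1.1 - (posB (g i)).1.1| ≤ h ∧
        |(posA (f i)).1.2 - (posB (g i)).1.2| ≤ h) ∧
      (∀ a, (∀ i, f i ≠ a) → (posA a).1.2 - (posA a).1.1 ≤ 2 * h) ∧
      (∀ b, (∀ i, g i ≠ b) → (posB b).1.2 - (posB b).1.1 ≤ 2 * h) := by
  have hh : 0 ≤ h := (abs_nonneg _).trans (H (Classical.arbitrary M))
  have H1 : ∀ P, ψ P ≤ φ P + h := fun P => by linarith [(abs_le.1 (H P)).1]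
  have H2 : ∀ P, φ P ≤ ψ P + h := fun P => by linarith [(abs_le.1 (H P)).2]
  have H0 : ∀ P, φ P ≤ φ P + 0 := fun P => (add_zero _).ge
  have H0' : ∀ P, ψ P ≤ ψ P + 0 := fun P => (add_zero _).ge
  obtain ⟨C, hV⟩ := isRankFunction_self hφ
  obtain ⟨C', hR⟩ := isRankFunction_pairRank hφ hψ H1
  obtain ⟨C'', hW⟩ := isRankFunction_self hψ
  rw [reducedSizeFunction_eq] at hA hB
  refine exists_barcode_matching hh hV hR hW hA hB ?_ ?_ ?_ ?_
  -- All four inequalities are `pairRank_add_le`, with level sets enlarged along `{φ ≤ x} ⊆ {ψ ≤ x +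
  -- h}` and `{ψ ≤ x} ⊆ {φ ≤ x + h}`.
  · intro x x' y hx hy
    exact pairRank_add_le hφ (lowerLevel_subset H0 (by linarith)) H0 (by linarith)
      (lowerLevel_subset H1 le_rfl)
  · intro x x' y hx hy
    exact pairRank_add_le hφ (lowerLevel_subset H0 (by linarith)) H1 (by linarith)
      (lowerLevel_subset H2 (by linarith))
  · intro x y y' hy hy'
    have := pairRank_add_le (φ := φ) (ψ := ψ) (ψ' := ψ) (y := y + h) (y' := y' + h) hψ
      (lowerLevel_subset (x := x) H1 le_rfl) H0' (by linarith) (lowerLevel_subset H0' (by linarith))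
    omega
  · intro x y y' hy hy'
    have := pairRank_add_le (φ := ψ) (ψ := ψ) (ψ' := ψ) (x := x - h) (y := y + h) (y' := y' + h) hφ
      (lowerLevel_subset (y := x) H2 (by linarith)) H1 (by linarith)
      (lowerLevel_subset H0' (by linarith))
    omega

/-! ### The distance on the extended half-plane -/

lemma DeltaPlus.toExt_injective : Function.Injective DeltaPlus.toExt := fun p q h => by
  injection h with h1 h2
  exact Subtype.ext (Prod.ext h1 h2)

lemma DeltaPlus.not_onDiagonal_toExt (p : DeltaPlus) : ¬ p.toExt.OnDiagonal := by
  rintro ⟨x, h⟩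
  injection h with h1 h2
  have := p.2
  rw [h1, h2] at this
  exact lt_irrefl _ this

lemma ExtPoint.not_onDiagonal_infinite (k : ℝ) : ¬ (ExtPoint.infinite k).OnDiagonal := by
  rintro ⟨x, h⟩
  cases h

lemma ExtPoint.d_comm : ∀ p q : ExtPoint, p.d q = q.d p
  | .finite x y _, .finite x' y' _ => by
      simp only [ExtPoint.d]
      rw [abs_sub_comm x, abs_sub_comm y, max_comm ((y - x) / 2)]
  | .infinite k, .infinite k' => by
      simp only [ExtPoint.d]
      rw [abs_sub_comm]
  | .finite _ _ _, .infinite _ => rfl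
  | .infinite _, .finite _ _ _ => rfl

/-- The distance from a point of the diagonal to a finite point is half the length of the latter. -/
lemma ExtPoint.d_diagonal (z x y : ℝ) (h : x ≤ y) :
    (ExtPoint.finite z z le_rfl).d (.finite x y h) = ENNReal.ofReal ((y - x) / 2) := by
  simp only [ExtPoint.d]
  congr 1
  have h0 : (z - z) / 2 ≤ (y - x) / 2 := by linarith
  rw [max_eq_right h0, min_eq_right]
  -- Since `y - x ≤ |z - x| + |z - y|`, the direct move costs at least half the length.
  have h1 := le_max_left |z - x| |z - y|
  have h2 := le_max_right |z - x| |z - y|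
  have h3 := le_abs_self (z - x)
  have h4 := neg_abs_le (z - y)
  linarith

lemma ExtPoint.d_congr_of_onDiagonal {p p' : ExtPoint} (hp : p.OnDiagonal) (hp' : p'.OnDiagonal) :
    ∀ q : ExtPoint, p.d q = p'.d q := by
  obtain ⟨x, rfl⟩ := hp
  obtain ⟨x', rfl⟩ := hp'
  rintro (⟨u, v, h⟩ | k)
  · rw [d_diagonal, d_diagonal]
  · rfl

lemma ExtPoint.d_le_of_short {x y x' y' w : ℝ} (h : x ≤ y) (h' : x' ≤ y') (hw : y - x ≤ 2 * w)
    (hw' : y' - x' ≤ 2 * w) :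
    (ExtPoint.finite x y h).d (.finite x' y' h') ≤ ENNReal.ofReal w := by
  refine ENNReal.ofReal_le_ofReal ((min_le_right _ _).trans (max_le ?_ ?_)) <;> linarith

lemma ExtPoint.d_le_of_close {x y x' y' w : ℝ} (h : x ≤ y) (h' : x' ≤ y') (hw : |x - x'| ≤ w)
    (hw' : |y - y'| ≤ w) :
    (ExtPoint.finite x y h).d (.finite x' y' h') ≤ ENNReal.ofReal w :=
  ENNReal.ofReal_le_ofReal ((min_le_left _ _).trans (max_le hw hw'))

/-! ### Countability of cornerpoints and existence of representative sequences -/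

namespace IsRankFunction

variable {r : ℝ → ℝ → ℕ} {m C : ℝ}

lemma lt_of_multiplicity_pos_left (hr : IsRankFunction r m C) {p : DeltaPlus}
    (hp : 0 < multiplicity (onDeltaPlus r) p) {ε q : ℝ} (h0 : 0 < ε) (h1 : p.1.1 + ε < q)
    (h2 : q + ε < p.1.2) : r (p.1.1 - ε) q < r (p.1.1 + ε) q := by
  have hl := (hr.isLeast_vertical p rfl rfl).2 ⟨ε, h0, by linarith, rfl⟩
  have h3 := (hr.isLineFamily_vertical p.1.1).anti h0 (s := q - p.1.1)
    (s' := p.1.2 - p.1.1 - ε) (by linarith) (by linarith)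
  have h4 : 0 < vertical r p.1.1 ε (q - p.1.1) := by omega
  rw [vertical, add_sub_cancel] at h4
  omega

lemma lt_of_multiplicity_pos_right (hr : IsRankFunction r m C) {p : DeltaPlus}
    (hp : 0 < multiplicity (onDeltaPlus r) p) {ε q : ℝ} (h0 : 0 < ε) (h1 : p.1.1 + ε < q)
    (h2 : q + ε < p.1.2) : r q (p.1.2 + ε) < r q (p.1.2 - ε) := by
  have hl := (hr.isLeast_horizontal p rfl rfl).2 ⟨ε, h0, by linarith, rfl⟩
  have h3 := (hr.isLineFamily_horizontal p.1.2).anti h0 (s := p.1.2 - q)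
    (s' := p.1.2 - p.1.1 - ε) (by linarith) (by linarith)
  have h4 : 0 < horizontal r p.1.2 ε (p.1.2 - q) := by omega
  rw [horizontal, sub_sub_cancel] at h4
  omega

lemma not_continuousAt_of_forall_ne {f : ℝ → ℕ} {x δ : ℝ} (hδ : 0 < δ)
    (h : ∀ ε, 0 < ε → ε < δ → f (x - ε) ≠ f (x + ε)) : ¬ ContinuousAt f x := by
  intro hc
  have h1 : ∀ᶠ z in nhds x, f z = f x := hc (mem_nhds_discrete.2 (Set.mem_singleton (f x)))
  obtain ⟨η, hη, h2⟩ := Metric.eventually_nhds_iff.1 h1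
  obtain ⟨ε, e0, e1⟩ := exists_between (lt_min hδ hη)
  rw [lt_min_iff] at e1
  refine h ε e0 e1.1 ((h2 ?_).trans (h2 ?_).symm)
  · rw [Real.dist_eq, sub_sub_cancel_left, abs_neg, abs_of_pos e0]
    exact e1.2
  · rw [Real.dist_eq, add_sub_cancel_left, abs_of_pos e0]
    exact e1.2

/-- Choose rationals `q < q'` strictly between the coordinates of a cornerpoint. Its abscissa is a
discontinuity of `r · q'` and its ordinate one of `r q ·`; monotone functions have countably many.
Truncation by `min` and `max` extends these functions monotonically to the whole line. -/
lemma countable_properCornerpoints (hr : IsRankFunction r m C) :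
    {p : DeltaPlus | 0 < multiplicity (onDeltaPlus r) p}.Countable := by
  have hX : (⋃ q : {q : ℚ × ℚ // q.1 < q.2},
      {x : ℝ | ¬ ContinuousAt (fun z => r (min z q.1.1) q.1.2) x}).Countable := by
    refine Set.countable_iUnion fun ⟨q, hq⟩ => Monotone.countable_not_continuousAt fun z z' h => ?_
    have hq' : (q.1 : ℝ) < q.2 := by exact_mod_cast hq
    exact hr.mono (min_le_min_right _ h) ((min_le_right _ _).trans_lt hq')
  have hY : (⋃ q : {q : ℚ × ℚ // q.1 < q.2},
      {x : ℝ | ¬ ContinuousAt (fun z => r q.1.1 (max z q.1.2)) x}).Countable := by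
    refine Set.countable_iUnion fun ⟨q, hq⟩ => Antitone.countable_not_continuousAt fun z z' h => ?_
    have hq' : (q.1 : ℝ) < q.2 := by exact_mod_cast hq
    exact hr.anti (hq'.trans_le (le_max_right _ _)) (max_le_max_right _ h)
  refine ((hX.prod hY).preimage Subtype.val_injective).mono fun p hp => ?_
  obtain ⟨q, h1, h2⟩ := exists_rat_btwn p.2
  obtain ⟨q', h3, h4⟩ := exists_rat_btwn h2
  refine ⟨Set.mem_iUnion.2 ⟨⟨(q, q'), by exact_mod_cast h3⟩, ?_⟩,
    Set.mem_iUnion.2 ⟨⟨(q, q'), by exact_mod_cast h3⟩, ?_⟩⟩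
  · refine not_continuousAt_of_forall_ne (δ := min (q - p.1.1) (p.1.2 - q'))
      (lt_min (by linarith) (by linarith)) fun ε e0 e1 => ?_
    rw [lt_min_iff] at e1
    simp only
    rw [min_eq_left (by linarith), min_eq_left (by linarith)]
    exact (hr.lt_of_multiplicity_pos_left hp e0 (by linarith) (by linarith)).ne
  · refine not_continuousAt_of_forall_ne (δ := min (q - p.1.1) (p.1.2 - q'))
      (lt_min (by linarith) (by linarith)) fun ε e0 e1 => ?_
    rw [lt_min_iff] at e1
    simp only
    rw [max_eq_left (by linarith), max_eq_left (by linarith)]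
    exact (hr.lt_of_multiplicity_pos_right hp e0 (by linarith) (by linarith)).ne'

lemma countable_bars (hr : IsRankFunction r m C) : Countable (Bars (onDeltaPlus r)) := by
  have := hr.countable_properCornerpoints.to_subtype
  refine Function.Injective.countable (f := fun b : Bars (onDeltaPlus r) =>
    ((⟨b.1, Int.lt_toNat.1 (b.2.pos)⟩ : {p : DeltaPlus | 0 < multiplicity (onDeltaPlus r) p}),
      (b.2 : ℕ))) ?_
  rintro ⟨p, n⟩ ⟨p', n'⟩ h
  obtain ⟨h1, h2⟩ := Prod.mk.inj h
  obtain rfl : p = p' := congrArg Subtype.val h1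
  exact congrArg _ (Fin.ext h2)

lemma exists_isRepresentativeSequence (hr : IsRankFunction r m C) :
    ∃ a, IsRepresentativeSequence (onDeltaPlus r) a := by
  classical
  obtain ⟨enc, henc⟩ := hr.countable_bars.exists_injective_nat
  -- Bars take odd indices: index `0` is kept for the point at infinity, and the positive even
  -- indices supply infinitely many diagonal points.
  set e : Bars (onDeltaPlus r) → ℕ := fun b => 2 * enc b + 1 with he
  have hinj : Function.Injective e := fun b b' h => henc (by simp only [he] at h; omega)
  set a : ℕ → ExtPoint := fun i => if i = 0 then .infinite m else
    if h : ∃ b, e b = i then h.choose.1.toExt else .finite 0 0 le_rfl with ha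
  have hbar : ∀ b, a (e b) = b.1.toExt := fun b => by
    have h : ∃ b', e b' = e b := ⟨b, rfl⟩
    have h1 : h.choose = b := hinj h.choose_spec
    simp only [ha]
    rw [if_neg (by simp only [he]; omega), dif_pos h, h1]
  have hdiag : ∀ i, i ≠ 0 → (¬ ∃ b, e b = i) → a i = .finite 0 0 le_rfl := fun i h0 h1 => by
    simp only [ha]
    rw [if_neg h0, dif_neg h1]
  refine ⟨a, ⟨m, (hr.isCornerpointAtInfinity_iff m).2 rfl, if_pos rfl⟩, fun i hi => ?_,
    fun p _ => ?_, ?_⟩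
  · by_cases h : ∃ b, e b = i
    · obtain ⟨b, rfl⟩ := h
      exact Or.inl ⟨b.1, Int.lt_toNat.1 (b.2.pos), hbar b⟩
    · exact Or.inr ⟨0, hdiag i hi.ne' h⟩
  · have h1 : {i | a i = p.toExt} = e '' {b | b.1 = p} := by
      ext i
      constructor
      · intro (hi : a i = p.toExt)
        by_cases h : ∃ b, e b = i
        · obtain ⟨b, rfl⟩ := h
          rw [hbar] at hi
          exact ⟨b, DeltaPlus.toExt_injective hi, rfl⟩
        · by_cases h0 : i = 0
          · rw [h0] at hi
            simp only [ha, if_true, DeltaPlus.toExt] at hi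
            cases hi
          · exact absurd ⟨0, hi ▸ hdiag i h0 h⟩ p.not_onDiagonal_toExt
      · rintro ⟨b, rfl, rfl⟩
        exact hbar b
    rw [h1, Set.ncard_image_of_injective _ hinj]
    exact (isBarcode_bars hr.multiplicity_nonneg p).2
  · refine Set.infinite_of_injective_forall_mem (f := fun k : ℕ => 2 * k + 2)
      (fun k k' h => by simp only at h; omega) fun k => ⟨0, hdiag _ (by omega) ?_⟩
    rintro ⟨b, hb⟩
    simp only [he] at hb
    omega

end IsRankFunction

/-! ### Independence of the choice of representative sequences -/

lemma nonempty_equiv_of_infinite {s t : Set ℕ} (hs : s.Infinite) (ht : t.Infinite) :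
    Nonempty (s ≃ t) := by
  have := hs.to_subtype
  have := ht.to_subtype
  obtain ⟨_⟩ := nonempty_denumerable s
  obtain ⟨_⟩ := nonempty_denumerable t
  exact ⟨Denumerable.equiv₂ s t⟩

/-- The indices of the terms of a sequence in the open half-plane. -/
abbrev OffDiagonal (a : ℕ → ExtPoint) : Type := {i : ℕ // ∃ p : DeltaPlus, a i = p.toExt}

namespace IsRepresentativeSequence

variable {r : ℝ → ℝ → ℕ} {m C : ℝ} {a : ℕ → ExtPoint}

lemma apply_zero (ha : IsRepresentativeSequence (onDeltaPlus r) a) (hr : IsRankFunction r m C) :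
    a 0 = .infinite m := by
  obtain ⟨k, h1, h2⟩ := ha.zero
  rw [h2, (hr.isCornerpointAtInfinity_iff k).1 h1]

lemma isProperCornerpoint {l : DeltaPlus → ℕ} (ha : IsRepresentativeSequence l a) {i : ℕ}
    {p : DeltaPlus} (hi : a i = p.toExt) : IsProperCornerpoint l p := by
  rcases Nat.eq_zero_or_pos i with rfl | h0
  · obtain ⟨k, -, h⟩ := ha.zero
    rw [h] at hi
    cases hi
  · rcases ha.pos i h0 with ⟨p', h1, h2⟩ | h1
    · rw [hi] at h2
      rwa [DeltaPlus.toExt_injective h2]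
    · rw [hi] at h1
      exact absurd h1 p.not_onDiagonal_toExt

lemma finite_and_ncard_eq {l : DeltaPlus → ℕ} (ha : IsRepresentativeSequence l a)
    (hl : ∀ p, 0 ≤ multiplicity l p) (p : DeltaPlus) :
    {i | a i = p.toExt}.Finite ∧ ({i | a i = p.toExt}.ncard : ℤ) = multiplicity l p := by
  by_cases hp : IsProperCornerpoint l p
  · have h := ha.card p hp
    -- An infinite set has `ncard` equal to `0`, so positive multiplicity forces finiteness.
    refine ⟨Set.finite_of_ncard_pos ?_, h⟩
    have : 0 < multiplicity l p := hp
    omega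
  · have h : {i | a i = p.toExt} = ∅ :=
      Set.eq_empty_of_forall_notMem fun i hi => hp (ha.isProperCornerpoint hi)
    rw [h]
    refine ⟨Set.finite_empty, ?_⟩
    rw [Set.ncard_empty]
    exact le_antisymm (hl p) (not_lt.1 hp)

lemma exists_isBarcode {l : DeltaPlus → ℕ} (ha : IsRepresentativeSequence l a)
    (hl : ∀ p, 0 ≤ multiplicity l p) :
    ∃ pos : OffDiagonal a → DeltaPlus,
      (∀ i : OffDiagonal a, a i = (pos i).toExt) ∧ IsBarcode l pos := by
  choose pos hpos using fun i : OffDiagonal a => i.2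
  refine ⟨pos, hpos, fun p => ?_⟩
  have e : Subtype.val '' {i | pos i = p} = {i | a i = p.toExt} := by
    ext i
    constructor
    · rintro ⟨i, rfl, rfl⟩
      exact hpos i
    · intro hi
      exact ⟨⟨i, p, hi⟩, DeltaPlus.toExt_injective ((hpos ⟨i, p, hi⟩).symm.trans hi), rfl⟩
  have h := ha.finite_and_ncard_eq hl p
  rw [← e, Set.ncard_image_of_injective _ Subtype.val_injective] at h
  exact ⟨h.1.of_finite_image Subtype.val_injective.injOn, h.2⟩

/-- Two representative sequences differ by a permutation and a change of the diagonal points. -/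
lemma exists_perm {a' : ℕ → ExtPoint} (ha : IsRepresentativeSequence (onDeltaPlus r) a)
    (ha' : IsRepresentativeSequence (onDeltaPlus r) a') (hr : IsRankFunction r m C) :
    ∃ τ : Equiv.Perm ℕ, ∀ i q, (a i).d q = (a' (τ i)).d q := by
  classical
  -- `cls` glues the diagonal to one point. Its fibres in the two sequences are equinumerous:
  -- infinite over the diagonal, of size the multiplicity over finite points, and `{0}` or empty at
  -- infinity.
  set cls : ExtPoint → Option ExtPoint := fun q => if q.OnDiagonal then none else some q with hcls
  have cls_none : ∀ q, cls q = none ↔ q.OnDiagonal := fun q => by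
    simp only [hcls]
    split_ifs with h <;> simp [h]
  have cls_some : ∀ q q', ¬ q'.OnDiagonal → (cls q = some q' ↔ q = q') := fun q q' hq' => by
    simp only [hcls]
    split_ifs with h
    · exact ⟨fun h => by simp at h, fun h' => absurd (h' ▸ h) hq'⟩
    · exact Option.some_inj
  have cls_d : ∀ q q', cls q = cls q' → ∀ s, q.d s = q'.d s := fun q q' h => by
    by_cases h' : q'.OnDiagonal
    · rw [(cls_none q').2 h', cls_none] at h
      exact ExtPoint.d_congr_of_onDiagonal h h'
    · have : cls q' = some q' := (cls_some _ _ h').2 rfl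
      rw [this, cls_some _ _ h'] at h
      rw [h]
      exact fun _ => rfl
  have hinf : ∀ {b : ℕ → ExtPoint}, IsRepresentativeSequence (onDeltaPlus r) b → ∀ k,
      {i | b i = .infinite k} = if k = m then {0} else ∅ := by
    intro b hb k
    ext i
    have h0 := hb.apply_zero hr
    rcases Nat.eq_zero_or_pos i with rfl | hi
    · change b 0 = _ ↔ _
      rw [h0, ExtPoint.infinite.injEq]
      split_ifs with h
      · simp [h]
      · simp [Ne.symm h]
    · have h1 : ¬ b i = .infinite k := fun h => by
        rcases hb.pos i hi with ⟨p, -, h2⟩ | h2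
        · rw [h] at h2
          cases h2
        · rw [h] at h2
          exact ExtPoint.not_onDiagonal_infinite k h2
      refine iff_of_false h1 ?_
      split_ifs
      · exact hi.ne'
      · exact Set.notMem_empty i
  obtain ⟨τ, hτ⟩ := exists_equiv_of_fiber_equiv (fun i => cls (a i)) (fun i => cls (a' i)) (by
    rintro (_ | q)
    · simp only [cls_none]
      exact nonempty_equiv_of_infinite ha.diagonal ha'.diagonal
    · by_cases hq : q.OnDiagonal
      · have h : ∀ q', ¬ cls q' = some q := fun q' h => by
          by_cases hq' : q'.OnDiagonal
          · rw [(cls_none q').2 hq'] at h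
            cases h
          · rw [(cls_some q' q' hq').2 rfl] at h
            exact hq' (Option.some_inj.1 h ▸ hq)
        simp only [h]
        exact ⟨Equiv.refl _⟩
      · simp only [cls_some _ _ hq]
        rcases q with ⟨x, y, hxy⟩ | k
        · have hlt : x < y := lt_of_le_of_ne hxy fun h => hq ⟨x, by subst h; rfl⟩
          have h1 := ha.finite_and_ncard_eq hr.multiplicity_nonneg ⟨(x, y), hlt⟩
          have h2 := ha'.finite_and_ncard_eq hr.multiplicity_nonneg ⟨(x, y), hlt⟩
          have := h1.1.to_subtype
          have := h2.1.to_subtype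
          have h3 : Nat.card {i | a i = DeltaPlus.toExt ⟨(x, y), hlt⟩} =
              Nat.card {i | a' i = DeltaPlus.toExt ⟨(x, y), hlt⟩} := by
            rw [Nat.card_coe_set_eq, Nat.card_coe_set_eq]
            exact_mod_cast h1.2.trans h2.2.symm
          have h4 : Nonempty ({i | a i = DeltaPlus.toExt ⟨(x, y), hlt⟩} ≃
              {i | a' i = DeltaPlus.toExt ⟨(x, y), hlt⟩}) := Finite.card_eq.1 h3
          exact h4
        · exact ⟨Equiv.setCongr ((hinf ha k).trans (hinf ha' k).symm)⟩)
  exact ⟨τ, fun i q => cls_d _ _ (hτ i).symm q⟩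

end IsRepresentativeSequence

lemma matchingCost_le_matchingCost {r r' : ℝ → ℝ → ℕ} {m C m' C' : ℝ} (hr : IsRankFunction r m C)
    (hr' : IsRankFunction r' m' C') {a a' b b' : ℕ → ExtPoint}
    (ha : IsRepresentativeSequence (onDeltaPlus r) a)
    (ha' : IsRepresentativeSequence (onDeltaPlus r) a')
    (hb : IsRepresentativeSequence (onDeltaPlus r') b)
    (hb' : IsRepresentativeSequence (onDeltaPlus r') b') :
    matchingCost a b ≤ matchingCost a' b' := by
  obtain ⟨τ, hτ⟩ := ha.exists_perm ha' hr
  obtain ⟨υ, hυ⟩ := hb.exists_perm hb' hr'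
  refine le_iInf fun σ => (iInf_le _ ((τ.trans σ).trans υ.symm)).trans (iSup_le fun i => ?_)
  refine le_trans (le_of_eq ?_) (le_iSup _ (τ i))
  simp only [Equiv.trans_apply]
  rw [hτ, ExtPoint.d_comm, hυ, Equiv.apply_symm_apply, ExtPoint.d_comm]

lemma matchingCost_eq_matchingDist {r r' : ℝ → ℝ → ℕ} {m C m' C' : ℝ}
    (hr : IsRankFunction r m C) (hr' : IsRankFunction r' m' C') {a b : ℕ → ExtPoint}
    (ha : IsRepresentativeSequence (onDeltaPlus r) a)
    (hb : IsRepresentativeSequence (onDeltaPlus r') b) :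
    matchingCost a b = matchingDist (onDeltaPlus r) (onDeltaPlus r') := by
  refine le_antisymm ?_ ?_
  · exact le_iInf fun a' => le_iInf fun b' => le_iInf fun ha' => le_iInf fun hb' =>
      matchingCost_le_matchingCost hr hr' ha ha' hb hb'
  · exact iInf_le_of_le a (iInf_le_of_le b (iInf_le_of_le ha (iInf_le _ hb)))

/-! ### From partial matchings to permutations, and the final bound -/

/-- Injections into `ℕ` with infinite complements of the ranges are intertwined by a permutation. -/
lemma exists_perm_comp_eq {κ : Type*} {f g : κ → ℕ} (hf : Function.Injective f)
    (hg : Function.Injective g) (hf' : (Set.range f)ᶜ.Infinite) (hg' : (Set.range g)ᶜ.Infinite) :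
    ∃ σ : Equiv.Perm ℕ, (∀ k, σ (f k) = g k) ∧ ∀ i, i ∉ Set.range f → σ i ∉ Set.range g := by
  classical
  obtain ⟨e⟩ := nonempty_equiv_of_infinite hf' hg'
  let σ : Equiv.Perm ℕ := (Equiv.Set.sumCompl (Set.range f)).symm.trans
    ((Equiv.sumCongr ((Equiv.ofInjective f hf).symm.trans (Equiv.ofInjective g hg)) e).trans
      (Equiv.Set.sumCompl (Set.range g)))
  refine ⟨σ, fun k => ?_, fun i hi => ?_⟩
  · simp only [σ, Equiv.trans_apply]
    rw [Equiv.Set.sumCompl_symm_apply_of_mem (Set.mem_range_self k)]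
    simp [Equiv.ofInjective_symm_apply]
  · simp only [σ, Equiv.trans_apply]
    rw [Equiv.Set.sumCompl_symm_apply_of_notMem hi]
    exact (e ⟨i, hi⟩).2

/-- The matching cost of representative sequences of reduced size functions of functions on the
same space is at most the uniform distance of the functions. -/
theorem matchingCost_le_ofReal {M : Type*} [TopologicalSpace M] [CompactSpace M]
    [ConnectedSpace M] [LocallyConnectedSpace M] {φ ψ : M → ℝ} (hφ : Continuous φ)
    (hψ : Continuous ψ) {h : ℝ} (H : ∀ P, |φ P - ψ P| ≤ h) {a b : ℕ → ExtPoint}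
    (ha : IsRepresentativeSequence (reducedSizeFunction φ) a)
    (hb : IsRepresentativeSequence (reducedSizeFunction ψ) b) :
    matchingCost a b ≤ ENNReal.ofReal h := by
  have hh : 0 ≤ h := (abs_nonneg _).trans (H (Classical.arbitrary M))
  obtain ⟨C, hr⟩ := isRankFunction_self hφ
  obtain ⟨C', hr'⟩ := isRankFunction_self hψ
  have hm : |(⨅ P, φ P) - ⨅ P, ψ P| ≤ h := by
    have h1 : (⨅ P, ψ P) - h ≤ ⨅ P, φ P := le_ciInf fun P => by
      linarith [ciInf_le (isCompact_range hψ).bddBelow P, (abs_le.1 (H P)).1]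
    have h2 : (⨅ P, φ P) - h ≤ ⨅ P, ψ P := le_ciInf fun P => by
      linarith [ciInf_le (isCompact_range hφ).bddBelow P, (abs_le.1 (H P)).2]
    rw [abs_le]
    constructor <;> linarith
  have hmult : ∀ p, 0 ≤ multiplicity (reducedSizeFunction φ) p := by
    rw [reducedSizeFunction_eq]; exact hr.multiplicity_nonneg
  have hmult' : ∀ p, 0 ≤ multiplicity (reducedSizeFunction ψ) p := by
    rw [reducedSizeFunction_eq]; exact hr'.multiplicity_nonneg
  obtain ⟨posA, hposA, hA⟩ := ha.exists_isBarcode hmult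
  obtain ⟨posB, hposB, hB⟩ := hb.exists_isBarcode hmult'
  obtain ⟨ι, f, g, hf, hg, hclose, hshortA, hshortB⟩ :=
    exists_barcode_matching_of_abs_sub_le hφ hψ H hA hB
  rw [reducedSizeFunction_eq] at ha hb
  -- The partial matching is enlarged by pairing index `0` with index `0`, through `none`. The
  -- remaining indices, infinitely many on each side, carry diagonal points or short bars, so any
  -- bijection between them is good enough.
  have extend : ∀ {r : ℝ → ℝ → ℕ} {m C : ℝ} {a : ℕ → ExtPoint}, IsRankFunction r m C →
      IsRepresentativeSequence (onDeltaPlus r) a →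
      ∀ (pos : OffDiagonal a → DeltaPlus) (_ : ∀ i : OffDiagonal a, a i = (pos i).toExt)
        (f : ι → OffDiagonal a) (_ : Function.Injective f)
        (_ : ∀ a, (∀ i, f i ≠ a) → (pos a).1.2 - (pos a).1.1 ≤ 2 * h),
        Function.Injective (fun o : Option ι => o.elim 0 fun i => (f i : ℕ)) ∧
        (Set.range (fun o : Option ι => o.elim 0 fun i => (f i : ℕ)))ᶜ.Infinite ∧
        ∀ i, i ∉ Set.range (fun o : Option ι => o.elim 0 fun i => (f i : ℕ)) →
          ∃ (x y : ℝ) (hxy : x ≤ y), a i = .finite x y hxy ∧ y - x ≤ 2 * h := by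
    intro r m C a hr ha pos hpos f hf hshort
    have h0 := ha.apply_zero hr
    refine ⟨?_, ?_, ?_⟩
    · have hne : ∀ i, (f i : ℕ) ≠ 0 := fun i e => by
        have := hpos (f i)
        rw [e, h0] at this
        cases this
      rintro (_ | i) (_ | j) e
      · rfl
      · exact absurd e.symm (hne j)
      · exact absurd e (hne i)
      · rw [hf (Subtype.ext e)]
    · refine ha.diagonal.mono ?_
      rintro i hi ⟨_ | j, rfl⟩
      · simp only [Option.elim, Set.mem_ofPred_eq] at hi
        rw [h0] at hi
        exact ExtPoint.not_onDiagonal_infinite _ hi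
      · simp only [Option.elim, Set.mem_ofPred_eq] at hi
        rw [hpos] at hi
        exact DeltaPlus.not_onDiagonal_toExt _ hi
    · intro i hi
      have hi0 : 0 < i := Nat.pos_of_ne_zero fun e => hi ⟨none, e.symm⟩
      rcases ha.pos i hi0 with ⟨p, -, hp⟩ | ⟨x, hx⟩
      · refine ⟨_, _, _, hpos ⟨i, p, hp⟩, hshort _ fun j e => hi ⟨some j, ?_⟩⟩
        exact congrArg Subtype.val e
      · exact ⟨x, x, le_rfl, hx, by linarith⟩
  obtain ⟨f1, f2, f3⟩ := extend hr ha posA hposA f hf hshortA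
  obtain ⟨g1, g2, g3⟩ := extend hr' hb posB hposB g hg hshortB
  obtain ⟨σ, hσ, hσ'⟩ := exists_perm_comp_eq f1 g1 f2 g2
  refine (iInf_le _ σ).trans (iSup_le fun i => ?_)
  by_cases hi : i ∈ Set.range (fun o : Option ι => o.elim 0 fun i => (f i : ℕ))
  · obtain ⟨_ | j, rfl⟩ := hi
    · rw [hσ]
      simp only [Option.elim]
      rw [ha.apply_zero hr, hb.apply_zero hr']
      exact ENNReal.ofReal_le_ofReal hm
    · rw [hσ]
      simp only [Option.elim]
      rw [hposA, hposB]
      exact ExtPoint.d_le_of_close _ _ (hclose j).1 (hclose j).2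
  · obtain ⟨x, y, hxy, e1, h1⟩ := f3 i hi
    obtain ⟨x', y', hxy', e2, h2⟩ := g3 _ (hσ' i hi)
    rw [e1, e2]
    exact ExtPoint.d_le_of_short _ _ h1 h2

end SizeTheory

theorem theorem5p2 {M N : Type*}
    [TopologicalSpace M] [CompactSpace M] [T2Space M] [ConnectedSpace M] [LocallyConnectedSpace M]
    [TopologicalSpace N] [CompactSpace N] [T2Space N] [ConnectedSpace N] [LocallyConnectedSpace N]
    (φ : M → ℝ) (hφ : Continuous φ) (ψ : N → ℝ) (hψ : Continuous ψ)
    (hMN : Nonempty (M ≃ₜ N)) :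
    -- the matching distance is well defined: representative sequences exist, and any two of them
    -- give the same value
    (∃ a, SizeTheory.IsRepresentativeSequence (SizeTheory.reducedSizeFunction φ) a) ∧
    (∃ b, SizeTheory.IsRepresentativeSequence (SizeTheory.reducedSizeFunction ψ) b) ∧
    (∀ a b, SizeTheory.IsRepresentativeSequence (SizeTheory.reducedSizeFunction φ) a →
      SizeTheory.IsRepresentativeSequence (SizeTheory.reducedSizeFunction ψ) b →
      SizeTheory.matchingCost a b =
        SizeTheory.matchingDist (SizeTheory.reducedSizeFunction φ)
          (SizeTheory.reducedSizeFunction ψ)) ∧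
    -- it is at most the natural pseudo-distance
    SizeTheory.matchingDist (SizeTheory.reducedSizeFunction φ) (SizeTheory.reducedSizeFunction ψ)
      ≤ ENNReal.ofReal (SizeTheory.naturalPseudoDist φ ψ) := by
  obtain ⟨C, hr⟩ := SizeTheory.isRankFunction_self hφ
  obtain ⟨C', hr'⟩ := SizeTheory.isRankFunction_self hψ
  obtain ⟨a, ha⟩ := hr.exists_isRepresentativeSequence
  obtain ⟨b, hb⟩ := hr'.exists_isRepresentativeSequence
  have key := fun {a b} => SizeTheory.matchingCost_eq_matchingDist hr hr' (a := a) (b := b)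
  simp only [← SizeTheory.reducedSizeFunction_eq] at ha hb key
  refine ⟨⟨a, ha⟩, ⟨b, hb⟩, fun a b ha hb => key ha hb, ?_⟩
  rw [← key ha hb]
  have hle : ∀ h : M ≃ₜ N,
      SizeTheory.matchingCost a b ≤ ENNReal.ofReal (⨆ P : M, |φ P - ψ (h P)|) := fun h => by
    have hψh : Continuous (ψ ∘ h) := hψ.comp h.continuous
    refine SizeTheory.matchingCost_le_ofReal hφ hψh (fun P => ?_) ha
      (by rwa [SizeTheory.reducedSizeFunction_comp_homeomorph])
    exact le_ciSup (f := fun P => |φ P - ψ (h P)|)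
      (isCompact_range (hφ.sub hψh).abs).bddAbove P
  -- A homeomorphism exists, so the cost is finite and can be compared in `ℝ` with a real infimum
  -- over a nonempty family.
  have htop : SizeTheory.matchingCost a b ≠ ⊤ :=
    ((hle hMN.some).trans_lt ENNReal.ofReal_lt_top).ne
  rw [← ENNReal.ofReal_toReal htop]
  refine ENNReal.ofReal_le_ofReal (le_ciInf fun h => ?_)
  refine ENNReal.toReal_le_of_le_ofReal ?_ (hle h)
  exact Real.iSup_nonneg fun P => abs_nonneg _
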